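/- Let $K$ be a field, $d\ge 0$, let $\mathcal G_d$ be the free monoid of words in the letters $g_1,\dots,g_d$, and write $z^w$ for the noncommutative monomial belonging to $w\in\mathcal G_d$. Matrix-valued noncommutative rational expressions in $\ell$ tuples $z^{(k)}=(z^{(k)}_1,\dots,z^{(k)}_d)$, $k=1,\dots,\ell$, of noncommuting indeterminates (indeterminates of different tuples commute) are obtained from the matrix-valued polynomials $\sum P_{w_1,\dots,w_\ell}\,(z^{(1)})^{w_1}\otimes\cdots\otimes(z^{(\ell)})^{w_\ell}$ by successive addition, multiplication, inversion and forming block matrices. They are evaluated at $\ell$-tuples $(Z^{(1)},\dots,Z^{(\ell)})$ of $d$-tuples of square matrices over $K$ of arbitrary positive sizes $n_1,\dots,n_\ell$, with values in $K^{p\times q}\otimes K^{n_1\times n_1}\otimes\cdots\otimes K^{n_\ell\times n_\ell}$; the domain of an expression is the set of the points at which all inverses involved exist, and an expression that is invertible at no point of its domain is never inverted. Two expressions are equivalent if their domains meet and they agree on the intersection of the domains. A $p\times q$ matrix-valued noncommutative rational function in $\ell$ tuples is an equivalence class of expressions; for $\ell=1$ these are the $p\times q$ matrices over the free skew field $\mathcal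 F$ of noncommutative rational functions in $z_1,\dots,z_d$ over $K$, and $p\times q$ matrices over $\mathcal F^{\otimes\ell}$ are identified with the classes of those expressions in which every inverted subexpression involves one tuple only. A function is regular at zero if some expression representing it has $(0,\dots,0)$ (with all sizes equal to $1$) in its domain. An expression that is regular at zero has a formal power series expansion, calculated recursively by adding and multiplying power series and by inverting power series with invertible constant term; the expansion, and the value at $(0,\dots,0)$, of a function regular at zero are those of any expression representing it that is regular at zero. For $j=1,\dots,d$ the operator $\Delta_j$ takes expressions in $\ell$ tuples to expressions in $\ell+1$ tuples: it sends $P\,(z^{(1)})^{w_1}\otimes\cdots\otimes(z^{(\ell)})^{w_\ell}$ to $\sum_{w_\ell=ug_jv}P\,(z^{(1)})^{w_1}\otimes\cdots\otimes (z^{(\ell)})^{u}\otimes(z^{(\ell+1)})^{v}$, it is additive, acts entrywise on block matrices, and $$\Delta_j(RS)=\Delta_j(R)\,\iota(S)+(R\otimes1)\,\Delta_j(S),\qquad \Delta_j(R^{-1})=-(R^{-1}\otimes1)\,\Delta_j(R)\,\iota(R^{-1}),$$ where $\iota(r_1\otimes\cdots\otimes r_\ell)=r_1\otimes\cdots\otimes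 r_{\ell-1}\otimes1\otimes r_\ell$. For a function $\mathfrak R$, $\Delta_j\mathfrak R$ is the class of $\Delta_j(R)$ for any expression $R$ representing $\mathfrak R$, and for a word $w=g_{i_\ell}\cdots g_{i_1}$ one puts $\Delta^w=\Delta_{i_\ell}\cdots\Delta_{i_1}$ and $w^{T}=g_{i_1}\cdots g_{i_\ell}$. **Theorem.** Let $\mathfrak R$ be a $p\times q$ matrix-valued noncommutative rational function in one tuple $z_1,\dots,z_d$ that is regular at zero. Then $\mathfrak R$ has a well-defined formal power series expansion $\sum_{w\in\mathcal G_d}\mathfrak R_wz^w$ with $\mathfrak R_w\in K^{p\times q}$, and: 1. for every $j$, $\Delta_j\mathfrak R$ is well defined and regular at zero, and has the formal power series expansion $\sum_{u,v\in\mathcal G_d}\mathfrak R_{ug_jv}\,z^u\otimes z'^{\,v}$; 2. for every word $w=g_{i_\ell}\cdots g_{i_1}$, $\ell\ge0$, $\Delta^w\mathfrak R$ is well defined and regular at zero, and has the formal power series expansion $$\sum_{u_1,\dots,u_{\ell+1}\in\mathcal G_d}\mathfrak R_{u_1g_{i_1}u_2g_{i_2}\cdots g_{i_\ell}u_{\ell+1}}\,(z^{(1)})^{u_1}\otimes(z^{(2)})^{u_2}\otimes\cdots\otimes(z^{(\ell+1)})^{u_{\ell+1}};$$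 3. in particular $\Delta^w\mathfrak R(0,\dots,0)=\mathfrak R_{w^{T}}$. -/

import Mathlib

universe u

namespace NCRat

/-! ### Matrix points -/

/-- A `d`-tuple of square matrices over `K`, of an arbitrary positive size: the rows and columns
are indexed by a finite nonempty type. -/
structure MatTuple (K : Type u) (d : ℕ) where
  n : Type
  [fintype : Fintype n]
  [decEq : DecidableEq n]
  [nonempty : Nonempty n]
  mat : Fin d → Matrix n n K

attribute [instance] MatTuple.fintype MatTuple.decEq MatTuple.nonempty

/-- A point `(Z⁽¹⁾, …, Z⁽ˡ⁾)`: each `Z⁽ᵏ⁾` is a `d`-tuple of square matrices of its own size. -/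
abbrev Point (K : Type u) (d l : ℕ) := Fin l → MatTuple K d

/-- The index set of the rows of `Mat_{n₁} ⊗ ⋯ ⊗ Mat_{nₗ}`. -/
abbrev Idx {K : Type u} {d l : ℕ} (x : Point K d l) := ∀ k, (x k).n

/-- `Mat_{n₁} ⊗ ⋯ ⊗ Mat_{nₗ}`, realised by Kronecker products. -/
abbrev TensorMat {K : Type u} {d l : ℕ} (x : Point K d l) := Matrix (Idx x) (Idx x) K

/-- The point `(0, …, 0)`, where every matrix has size `1`. -/
def zeroPoint (K : Type u) [Zero K] (d l : ℕ) : Point K d l :=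
  fun _ => { n := Fin 1, mat := 0 }

/-- An `l`-tuple of words in the letters `g₁, …, g_d`. -/
abbrev MultiWord (d l : ℕ) := Fin l → FreeMonoid (Fin d)

/-- `Z^w` for a word `w`. -/
noncomputable def wordEval {K : Type u} [Field K] {d : ℕ} (Z : MatTuple K d)
    (w : FreeMonoid (Fin d)) : Matrix Z.n Z.n K :=
  FreeMonoid.lift Z.mat w

/-- `(Z⁽¹⁾)^{w₁} ⊗ ⋯ ⊗ (Z⁽ˡ⁾)^{wₗ}`. -/
noncomputable def kron {K : Type u} [Field K] {d l : ℕ} (x : Point K d l) (w : MultiWord d l) :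
    TensorMat x :=
  Matrix.of fun i j => ∏ k, wordEval (x k) (w k) (i k) (j k)

/-! ### Matrix-valued noncommutative rational expressions in `l` tuples of indeterminates -/

/-- `p × q` matrix-valued noncommutative rational expressions in `l` tuples
`z⁽¹⁾, …, z⁽ˡ⁾` of `d` noncommuting indeterminates. The starting point are the matrix-valued
polynomials `∑_w P_w (z⁽¹⁾)^{w₁} ⊗ ⋯ ⊗ (z⁽ˡ⁾)^{wₗ}`. Nowhere invertible expressions must not be
inverted: this is `Expr.Valid` below. -/
inductive Expr (K : Type u) [Field K] (d l : ℕ) : ℕ → ℕ → Type u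
  | poly {p q : ℕ} (P : MultiWord d l →₀ Matrix (Fin p) (Fin q) K) : Expr K d l p q
  | add {p q : ℕ} (R S : Expr K d l p q) : Expr K d l p q
  | mul {p q r : ℕ} (R : Expr K d l p q) (S : Expr K d l q r) : Expr K d l p r
  | inv {p : ℕ} (R : Expr K d l p p) : Expr K d l p p
  | block {p₁ q₁ p₂ q₂ : ℕ} (R : Fin p₂ → Fin q₂ → Expr K d l p₁ q₁) :
      Expr K d l (p₂ * p₁) (q₂ * q₁)

namespace Expr

/-- The value `R(Z⁽¹⁾, …, Z⁽ˡ⁾)`, a `p × q` matrix over `Mat_{n₁} ⊗ ⋯ ⊗ Mat_{nₗ}`. It is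
meaningful on the domain `Expr.Dom`. -/
noncomputable def eval {K : Type u} [Field K] {d l : ℕ} (x : Point K d l) :
    {p q : ℕ} → Expr K d l p q → Matrix (Fin p) (Fin q) (TensorMat x)
  | _, _, poly P => Matrix.of fun a b => P.sum fun w A => A a b • kron x w
  | _, _, add R S => eval x R + eval x S
  | _, _, mul R S => eval x R * eval x S
  | _, _, inv R => Ring.inverse (eval x R)
  | _, _, block R => Matrix.of fun a b =>
      eval x (R (finProdFinEquiv.symm a).1 (finProdFinEquiv.symm b).1)
        (finProdFinEquiv.symm a).2 (finProdFinEquiv.symm b).2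

/-- The domain of regularity of `R`: all inverses in the calculation of `R(Z⁽¹⁾, …, Z⁽ˡ⁾)`
exist. -/
def Dom {K : Type u} [Field K] {d l : ℕ} (x : Point K d l) :
    {p q : ℕ} → Expr K d l p q → Prop
  | _, _, poly _ => True
  | _, _, add R S => Dom x R ∧ Dom x S
  | _, _, mul R S => Dom x R ∧ Dom x S
  | _, _, inv R => Dom x R ∧ IsUnit (eval x R)
  | _, _, block R => ∀ a b, Dom x (R a b)

/-- Every inverted subexpression is invertible at some point of its domain. -/
def Valid {K : Type u} [Field K] {d l : ℕ} : {p q : ℕ} → Expr K d l p q → Prop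
  | _, _, poly _ => True
  | _, _, add R S => Valid R ∧ Valid S
  | _, _, mul R S => Valid R ∧ Valid S
  | _, _, inv R => Valid R ∧ ∃ x : Point K d l, Dom x R ∧ IsUnit (eval x R)
  | _, _, block R => ∀ a b, Valid (R a b)

/-- A constant matrix, as an expression. -/
noncomputable def const {K : Type u} [Field K] {d l p q : ℕ} (A : Matrix (Fin p) (Fin q) K) :
    Expr K d l p q :=
  poly (Finsupp.single 1 A)

/-- `insertTuple k R` is the expression `R` in the `l` tuples of indeterminates other than the
`k`-th one, regarded as an expression in all `l + 1` tuples. For the last `k` it is `R ⊗ 1`; for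
the last but one it is `ι(R)`, the image of `R` under
`r₁ ⊗ ⋯ ⊗ rₗ ↦ r₁ ⊗ ⋯ ⊗ rₗ₋₁ ⊗ 1 ⊗ rₗ` (which is `1 ⊗ R` if `l = 1`). -/
noncomputable def insertTuple {K : Type u} [Field K] {d l : ℕ} (k : Fin (l + 1)) :
    {p q : ℕ} → Expr K d l p q → Expr K d (l + 1) p q
  | _, _, poly P => poly (P.mapDomain fun w => k.insertNth (α := fun _ => FreeMonoid (Fin d)) 1 w)
  | _, _, add R S => add (insertTuple k R) (insertTuple k S)
  | _, _, mul R S => mul (insertTuple k R) (insertTuple k S)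
  | _, _, inv R => inv (insertTuple k R)
  | _, _, block R => block fun a b => insertTuple k (R a b)

/-- `R ⊗ 1` -/
noncomputable def tensorOne {K : Type u} [Field K] {d l p q : ℕ} (R : Expr K d l p q) :
    Expr K d (l + 1) p q :=
  insertTuple (Fin.last l) R

/-- `ι(R)`; this is `1 ⊗ R` for an expression `R` in one tuple of indeterminates. -/
noncomputable def iota {K : Type u} [Field K] {d l p q : ℕ} (R : Expr K d (l + 1) p q) :
    Expr K d (l + 2) p q :=
  insertTuple (Fin.last l).castSucc R

/-- `Δ_j` on polynomials: `P_w (z⁽¹⁾)^{w₁} ⊗ ⋯ ⊗ (z⁽ˡ⁾)^{wₗ}` is sent to the sum of the terms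
`P_w (z⁽¹⁾)^{w₁} ⊗ ⋯ ⊗ (z⁽ˡ⁾)^u ⊗ (z⁽ˡ⁺¹⁾)^v` over all factorisations `wₗ = u g_j v`; here `g_j`
is the letter of `wₗ` at position `i`. -/
noncomputable def deltaPoly {K : Type u} [Field K] {d l p q : ℕ} (j : Fin d)
    (P : MultiWord d (l + 1) →₀ Matrix (Fin p) (Fin q) K) :
    MultiWord d (l + 2) →₀ Matrix (Fin p) (Fin q) K :=
  P.sum fun w A =>
    ∑ i : Fin (w (Fin.last l)).toList.length,
      if (w (Fin.last l)).toList.get i = j then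
        Finsupp.single
          (Fin.snoc (α := fun _ => FreeMonoid (Fin d))
            (Fin.snoc (α := fun _ => FreeMonoid (Fin d)) (Fin.init w)
              (FreeMonoid.ofList ((w (Fin.last l)).toList.take i)))
            (FreeMonoid.ofList ((w (Fin.last l)).toList.drop (i + 1)))) A
      else 0

/-- The difference-differential operator `Δ_j` on expressions; it acts on the last tuple of
indeterminates. -/
noncomputable def delta {K : Type u} [Field K] {d l : ℕ} (j : Fin d) :
    {p q : ℕ} → Expr K d (l + 1) p q → Expr K d (l + 2) p q
  | _, _, poly P => poly (deltaPoly j P)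
  | _, _, add R S => add (delta j R) (delta j S)
  | _, _, mul R S => add (mul (delta j R) (iota S)) (mul (tensorOne R) (delta j S))
  | _, _, inv R =>
      mul (const (-1)) (mul (mul (tensorOne (inv R)) (delta j R)) (iota (inv R)))
  | _, _, block R => block fun a b => delta j (R a b)

end Expr

/-! ### Formal power series -/

/-- Formal power series `∑_w F_w (z⁽¹⁾)^{w₁} ⊗ ⋯ ⊗ (z⁽ˡ⁾)^{wₗ}` with `p × q` matrix
coefficients. -/
abbrev Series (K : Type u) (d l p q : ℕ) := MultiWord d l → Matrix (Fin p) (Fin q) K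

/-- The ways of writing every `w k` as a concatenation `u k * v k`; `s k` is the length of
`u k`. -/
abbrev Split {d l : ℕ} (w : MultiWord d l) := ∀ k, Fin ((w k).toList.length + 1)

/-- the left factor of a splitting -/
def Split.left {d l : ℕ} {w : MultiWord d l} (s : Split w) : MultiWord d l :=
  fun k => FreeMonoid.ofList ((w k).toList.take (s k))

/-- the right factor of a splitting -/
def Split.right {d l : ℕ} {w : MultiWord d l} (s : Split w) : MultiWord d l :=
  fun k => FreeMonoid.ofList ((w k).toList.drop (s k))

/-- total length of a tuple of words -/
def MultiWord.len {d l : ℕ} (w : MultiWord d l) : ℕ := ∑ k, (w k).toList.length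

theorem Split.len_right_lt {d l : ℕ} {w : MultiWord d l} (s : Split w) (h : s ≠ 0) :
    MultiWord.len s.right < MultiWord.len w := by
  obtain ⟨k, hk⟩ := Function.ne_iff.mp h
  have hk' : (s k : ℕ) ≠ 0 := fun h0 => hk (Fin.ext h0)
  refine Finset.sum_lt_sum (fun m _ => ?_) ⟨k, Finset.mem_univ _, ?_⟩
  · simp [Split.right]
  · have := (s k).isLt
    simp only [Split.right, FreeMonoid.toList_ofList, List.length_drop]
    omega

namespace Series

/-- the product of power series, `(F G)_w = ∑_{w = uv} F_u G_v` -/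
noncomputable def mul {K : Type u} [Field K] {d l p q r : ℕ} (F : Series K d l p q)
    (G : Series K d l q r) : Series K d l p r :=
  fun w => ∑ s : Split w, F s.left * G s.right

open Classical in
/-- the unit series -/
noncomputable def one (K : Type u) [Field K] (d l p : ℕ) : Series K d l p p :=
  fun w => if w = 1 then 1 else 0

/-- The inverse of a power series with invertible constant term, calculated from
`∑_{w = uv} F_u G_v = δ_{w,∅}`. -/
noncomputable def inv {K : Type u} [Field K] {d l p : ℕ} (F : Series K d l p p) :
    Series K d l p p := fun w =>
  (F 1)⁻¹ * (one K d l p w -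
    ∑ s : Split w, if h : s ≠ 0 then F s.left * inv F s.right else 0)
termination_by w => MultiWord.len w
decreasing_by exact s.len_right_lt h

/-- `inv` is a right inverse. -/
theorem mul_inv_eq_one {K : Type u} [Field K] {d l p : ℕ} (F : Series K d l p p)
    (h : IsUnit (F 1)) : mul F (inv F) = one K d l p := by
  funext w
  have hdet : IsUnit (F 1).det := (Matrix.isUnit_iff_isUnit_det _).mp h
  have h1 : (0 : Split w).left = 1 := by
    funext k; simp [Split.left]
  have h2 : (0 : Split w).right = w := by
    funext k; simp [Split.right]
  have key : F 1 * inv F w = one K d l p w -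
      ∑ s : Split w, if s ≠ 0 then F s.left * inv F s.right else 0 := by
    rw [inv, ← mul_assoc, Matrix.mul_nonsing_inv _ hdet, one_mul]
    simp only [dite_eq_ite]
  have : mul F (inv F) w = F 1 * inv F w +
      ∑ s : Split w, if s ≠ 0 then F s.left * inv F s.right else 0 := by
    have e : ∀ s : Split w, F s.left * inv F s.right =
        (if s = 0 then F 1 * inv F w else 0) +
          (if s ≠ 0 then F s.left * inv F s.right else 0) := by
      intro s
      by_cases hs : s = 0
      · subst hs; simp [h1, h2]
      · simp [hs]
    unfold mul
    rw [Finset.sum_congr rfl fun s _ => e s, Finset.sum_add_distrib]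
    simp
  rw [this, key]
  abel

end Series

namespace Expr

/-- The formal power series expansion of an expression; it is meaningful for an expression that
is regular at zero. -/
noncomputable def series {K : Type u} [Field K] {d l : ℕ} :
    {p q : ℕ} → Expr K d l p q → Series K d l p q
  | _, _, poly P => P
  | _, _, add R S => series R + series S
  | _, _, mul R S => (series R).mul (series S)
  | _, _, inv R => (series R).inv
  | _, _, block R => fun w => Matrix.of fun a b =>
      series (R (finProdFinEquiv.symm a).1 (finProdFinEquiv.symm b).1) w
        (finProdFinEquiv.symm a).2 (finProdFinEquiv.symm b).2

/-- `(0, …, 0)` lies in the domain of regularity of `R`. -/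
def RegularAtZero {K : Type u} [Field K] {d l p q : ℕ} (R : Expr K d l p q) : Prop :=
  Dom (zeroPoint K d l) R

/-- `R(0, …, 0)`, a `p × q` matrix. -/
noncomputable def valueAtZero {K : Type u} [Field K] {d l p q : ℕ} (R : Expr K d l p q) :
    Matrix (Fin p) (Fin q) K :=
  Matrix.of fun a b => eval (zeroPoint K d l) R a b (fun _ => (0 : Fin 1)) (fun _ => (0 : Fin 1))

/-! `Δ_j` does not leave the valid expressions. -/

/-- The embedding `A ↦ A ⊗ I` that inserts an identity matrix as the `k`-th tensor factor. -/
def insertId {K : Type u} [Field K] {d l : ℕ} (k : Fin (l + 1)) (x : Point K d (l + 1)) :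
    TensorMat (fun m => x (k.succAbove m)) →+* TensorMat x where
  toFun A := Matrix.of fun i j =>
    if i k = j k then A (fun m => i (k.succAbove m)) (fun m => j (k.succAbove m)) else 0
  map_one' := by
    ext i j
    by_cases h : i = j
    · subst h; simp
    · rw [Matrix.one_apply_ne h, Matrix.of_apply]
      split_ifs with hk
      · refine Matrix.one_apply_ne fun h' => h ?_
        funext m
        rcases Fin.eq_self_or_eq_succAbove k m with rfl | ⟨m, rfl⟩
        · exact hk
        · exact congrFun h' m
      · rfl
  map_mul' A B := by
    ext i j
    rw [Matrix.mul_apply,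
      ← (Fin.insertNthEquiv (fun m => (x m).n) k).sum_comp, Fintype.sum_prod_type]
    simp only [Matrix.of_apply, Fin.insertNthEquiv_apply, Fin.insertNth_apply_same,
      Fin.insertNth_apply_succAbove, ite_mul, zero_mul, mul_ite, mul_zero]
    rw [Finset.sum_eq_single (i k)]
    · simp [Matrix.mul_apply]
    · intro b _ hb
      simp [Ne.symm hb]
    · simp
  map_zero' := by
    ext i j; simp
  map_add' A B := by
    ext i j
    simp only [Matrix.of_apply, Matrix.add_apply]
    split_ifs <;> simp

theorem insertId_kron {K : Type u} [Field K] {d l : ℕ} (k : Fin (l + 1)) (x : Point K d (l + 1))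
    (w : MultiWord d l) :
    insertId k x (kron (fun m => x (k.succAbove m)) w) =
      kron x (k.insertNth (α := fun _ => FreeMonoid (Fin d)) 1 w) := by
  ext i j
  simp only [insertId, kron, RingHom.coe_mk, MonoidHom.coe_mk, OneHom.coe_mk, Matrix.of_apply]
  rw [Fin.prod_univ_succAbove _ k]
  simp [wordEval, Matrix.one_apply]

theorem insertId_smul {K : Type u} [Field K] {d l : ℕ} (k : Fin (l + 1)) (x : Point K d (l + 1))
    (c : K) (A : TensorMat (fun m => x (k.succAbove m))) :
    insertId k x (c • A) = c • insertId k x A := by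
  ext i j
  simp [insertId]

theorem eval_insertTuple {K : Type u} [Field K] {d l : ℕ} (k : Fin (l + 1))
    (x : Point K d (l + 1)) {p q : ℕ} (R : Expr K d l p q) :
    Dom (fun m => x (k.succAbove m)) R →
      Dom x (insertTuple k R) ∧
        eval x (insertTuple k R) = (eval (fun m => x (k.succAbove m)) R).map (insertId k x) := by
  induction R with
  | poly P =>
    refine fun _ => ⟨trivial, ?_⟩
    ext1 a b
    simp only [insertTuple, eval, Matrix.of_apply, Matrix.map_apply]
    rw [Finsupp.sum_mapDomain_index (by simp) (by intros; simp [add_smul]), Finsupp.sum,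
      Finsupp.sum, map_sum]
    exact Finset.sum_congr rfl fun w _ => by rw [insertId_smul, insertId_kron]
  | add R S hR hS =>
    rintro ⟨h₁, h₂⟩
    refine ⟨⟨(hR h₁).1, (hS h₂).1⟩, ?_⟩
    simp only [insertTuple, eval, (hR h₁).2, (hS h₂).2]
    ext1 a b
    simp
  | mul R S hR hS =>
    rintro ⟨h₁, h₂⟩
    refine ⟨⟨(hR h₁).1, (hS h₂).1⟩, ?_⟩
    simp only [insertTuple, eval, (hR h₁).2, (hS h₂).2, Matrix.map_mul]
  | inv R hR =>
    rintro ⟨h₁, h₂⟩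
    have e := (hR h₁).2
    have hu : IsUnit (eval x (insertTuple k R)) := by
      rw [e]; exact h₂.map (insertId k x).mapMatrix
    refine ⟨⟨(hR h₁).1, hu⟩, ?_⟩
    have h3 : eval x (insertTuple k R) *
        (Ring.inverse (eval (fun m => x (k.succAbove m)) R)).map (insertId k x) = 1 := by
      rw [e, ← Matrix.map_mul, Ring.mul_inverse_cancel _ h₂]
      exact map_one (insertId k x).mapMatrix
    simp only [insertTuple, eval]
    rw [← one_mul (Matrix.map _ _), ← Ring.inverse_mul_cancel _ hu, mul_assoc, h3, mul_one]
  | block R hR =>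
    intro h
    refine ⟨fun a b => (hR a b (h a b)).1, ?_⟩
    ext1 a b
    simp only [insertTuple, eval, Matrix.of_apply, Matrix.map_apply, (hR _ _ (h _ _)).2]

theorem Valid.insertTuple {K : Type u} [Field K] {d l : ℕ} (k : Fin (l + 1)) {p q : ℕ}
    {R : Expr K d l p q} : Valid R → Valid (insertTuple k R) := by
  induction R with
  | poly P => exact fun _ => trivial
  | add R S hR hS => exact fun h => ⟨hR h.1, hS h.2⟩
  | mul R S hR hS => exact fun h => ⟨hR h.1, hS h.2⟩
  | inv R hR =>
    rintro ⟨h, x, hx, hu⟩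
    refine ⟨hR h, k.insertNth (α := fun _ => MatTuple K d) ⟨Fin 1, 0⟩ x, ?_⟩
    have hy : (fun m => (k.insertNth (α := fun _ => MatTuple K d) ⟨Fin 1, 0⟩ x :
        Point K d (l + 1)) (k.succAbove m)) = x := by
      funext m; simp
    generalize (k.insertNth (α := fun _ => MatTuple K d) ⟨Fin 1, 0⟩ x : Point K d (l + 1)) = y
      at hy ⊢
    subst hy
    obtain ⟨h1, h2⟩ := eval_insertTuple k y R hx
    refine ⟨h1, ?_⟩
    rw [h2]
    exact hu.map (insertId k y).mapMatrix
  | block R hR => exact fun h a b => hR a b (h a b)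

theorem Valid.delta {K : Type u} [Field K] {d l : ℕ} (j : Fin d) {p q : ℕ}
    {R : Expr K d (l + 1) p q} : Valid R → Valid (delta j R) := by
  induction R with
  | poly P => exact fun _ => trivial
  | add R S hR hS => exact fun h => ⟨hR h.1, hS h.2⟩
  | mul R S hR hS =>
    exact fun h => ⟨⟨hR h.1, h.2.insertTuple _⟩, ⟨h.1.insertTuple _, hS h.2⟩⟩
  | inv R hR =>
    intro h
    exact ⟨trivial, ⟨Valid.insertTuple (R := inv R) _ h, hR h.1⟩,
      Valid.insertTuple (R := inv R) _ h⟩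
  | block R hR => exact fun h a b => hR a b (h a b)

end Expr

/-! ### Noncommutative rational functions -/

/-- Noncommutative rational expressions: a nowhere invertible expression is never inverted. -/
abbrev RatExpr (K : Type u) [Field K] (d l p q : ℕ) := {R : Expr K d l p q // R.Valid}

/-- `R` and `S` have a common point in their domains and agree on all such points. -/
def Equivalent {K : Type u} [Field K] {d l p q : ℕ} (R S : RatExpr K d l p q) : Prop :=
  (∃ x, R.1.Dom x ∧ S.1.Dom x) ∧ ∀ x, R.1.Dom x → S.1.Dom x → R.1.eval x = S.1.eval x

/-- `p × q` matrix-valued noncommutative rational functions in `l` tuples of `d` noncommuting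
indeterminates: equivalence classes of expressions. For `l = 1` these are the `p × q` matrices
over the free skew field `𝓕`. For general `l` they comprise the `p × q` matrices over the `l`-fold
tensor power of `𝓕` over `K`, as the classes of the expressions whose inverted subexpressions each
involve one tuple only. -/
def RatFun (K : Type u) [Field K] (d l p q : ℕ) : Type u :=
  Quot (Equivalent (K := K) (d := d) (l := l) (p := p) (q := q))

namespace RatFun

/-- the function that an expression represents -/
def mk {K : Type u} [Field K] {d l p q : ℕ} (R : RatExpr K d l p q) : RatFun K d l p q :=
  Quot.mk _ R

/-- `(0, …, 0)` lies in the domain of regularity of `f`, the union of the domains of regularity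
of the expressions that represent `f`. -/
def RegularAtZero {K : Type u} [Field K] {d l p q : ℕ} (f : RatFun K d l p q) : Prop :=
  ∃ R : RatExpr K d l p q, mk R = f ∧ R.1.RegularAtZero

/-- `f` is regular at zero and has the formal power series expansion
`∑_w c_w (z⁽¹⁾)^{w₁} ⊗ ⋯ ⊗ (z⁽ˡ⁾)^{wₗ}`, whichever representing expression regular at zero is
expanded. -/
def HasExpansion {K : Type u} [Field K] {d l p q : ℕ} (f : RatFun K d l p q)
    (c : Series K d l p q) : Prop :=
  f.RegularAtZero ∧
    ∀ R : RatExpr K d l p q, mk R = f → R.1.RegularAtZero → R.1.series = c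

/-- `f` is regular at zero and `f(0, …, 0) = A`, whichever representing expression regular at
zero is evaluated. -/
def HasValueAtZero {K : Type u} [Field K] {d l p q : ℕ} (f : RatFun K d l p q)
    (A : Matrix (Fin p) (Fin q) K) : Prop :=
  f.RegularAtZero ∧
    ∀ R : RatExpr K d l p q, mk R = f → R.1.RegularAtZero → R.1.valueAtZero = A

/-- `g = Δ_j f`: the function `g` is the class of `Δ_j(R)` for any expression `R` that
represents `f`. -/
def IsDelta {K : Type u} [Field K] {d l p q : ℕ} (j : Fin d) (f : RatFun K d (l + 1) p q)
    (g : RatFun K d (l + 2) p q) : Prop :=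
  ∀ R : RatExpr K d (l + 1) p q, mk R = f → mk ⟨R.1.delta j, R.2.delta j⟩ = g

/-- `g = Δ^w f = Δ_{i_ℓ} ⋯ Δ_{i_1} f` for the word `w = g_{i_ℓ} ⋯ g_{i_1}`, given by the list
`[i_ℓ, …, i_1]`. -/
def IsHigherDelta {K : Type u} [Field K] {d p q : ℕ} :
    (w : List (Fin d)) → RatFun K d 1 p q → RatFun K d (w.length + 1) p q → Prop
  | [], f, g => g = f
  | j :: w, f, g => ∃ h : RatFun K d (w.length + 1) p q, IsHigherDelta w f h ∧ IsDelta j h g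

end RatFun

/-- The word `u₁ g_{i_1} u₂ g_{i_2} ⋯ g_{i_ℓ} u_{ℓ+1}` for `w = [i_ℓ, …, i_1]`. -/
def interleave {d : ℕ} (w : List (Fin d)) (u : MultiWord d (w.length + 1)) :
    FreeMonoid (Fin d) :=
  u 0 * (List.ofFn fun k : Fin w.length => FreeMonoid.of (w.get k.rev) * u k.succ).prod

end NCRat

/-! ### Evaluation of expressions along monoid homomorphisms -/

namespace NCRat

namespace Expr

variable {K : Type u} [Field K] {d l : ℕ}

/-! All evaluations are treated as evaluations along a monoid homomorphism φ from multiwords to a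
K-algebra (`Expr.evalHom`). Matrix points give the homomorphisms `kronHom`, and evaluation is
natural under algebra homomorphisms (`Expr.evalHom_comp`).

The rules for Δ_j say exactly that R ↦ [R ⊗ 1, Δ_j R; 0, ι R] respects sums, products and inverses.
Hence evaluating R along the block triangular homomorphism `triHom` produces the value of Δ_j R in
the corner (`Expr.evalHom_triHom`). At a matrix point this triangular matrix is, up to
amplification, the value of R at another matrix point, `triPoint`. So equivalent expressions have
equivalent images under Δ_j (`Equivalent.delta`).

If φ kills all but finitely many multiwords, an expression regular at zero is automatically defined
along φ, and its value is the finite sum ∑ F_w φ(w), where F is its expansion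
(`Expr.evalHom_eq_seriesEval`). Tuples of shift matrices give such a φ from which any chosen
coefficient can be read off (`detectPoint`). Therefore the expansion depends only on the values
(`Equivalent.series_eq`). Applied to the corner of `triHom`, the same principle shows that the
coefficient of Δ_j R at (…, u, v) is that of R at (…, u g_j v) (`Expr.series_delta`). Iteration
gives Δ^w, and the coefficient at empty words gives the value at zero.

A function is a class for the relation generated by `Equivalent`, so transitivity is needed. It
follows once two expressions with nonempty domains have a common point, at which moreover a nonzero
value of the first can be kept nonzero (`exists_common_point`). After amplification to equal sizes,
two points X, Y are joined by X + t(Y − X) with one parameter t_k for each tuple. The conditions at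
the two ends are nonzero polynomials in t. Over a finite field their product may vanish at all
scalars, so t_k is replaced by a matrix T_k in the k-th of several auxiliary tensor factors, chosen
such that the product becomes invertible (`exists_isUnit_aeval`). -/

/-- The value of an expression when `(z⁽¹⁾)^{w₁} ⊗ ⋯ ⊗ (z⁽ˡ⁾)^{wₗ}` is replaced by `φ w`. -/
noncomputable def evalHom {B : Type*} [Ring B] [Algebra K B] (φ : MultiWord d l →* B) :
    {p q : ℕ} → Expr K d l p q → Matrix (Fin p) (Fin q) B
  | _, _, poly P => Matrix.of fun a b => P.sum fun w A => A a b • φ w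
  | _, _, add R S => evalHom φ R + evalHom φ S
  | _, _, mul R S => evalHom φ R * evalHom φ S
  | _, _, inv R => Ring.inverse (evalHom φ R)
  | _, _, block R => Matrix.of fun a b =>
      evalHom φ (R (finProdFinEquiv.symm a).1 (finProdFinEquiv.symm b).1)
        (finProdFinEquiv.symm a).2 (finProdFinEquiv.symm b).2

/-- All inverses in the calculation of `evalHom φ R` exist. -/
def DomHom {B : Type*} [Ring B] [Algebra K B] (φ : MultiWord d l →* B) :
    {p q : ℕ} → Expr K d l p q → Prop
  | _, _, poly _ => True
  | _, _, add R S => DomHom φ R ∧ DomHom φ S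
  | _, _, mul R S => DomHom φ R ∧ DomHom φ S
  | _, _, inv R => DomHom φ R ∧ IsUnit (evalHom φ R)
  | _, _, block R => ∀ a b, DomHom φ (R a b)

theorem ringInverse_eq_of_mul_eq_one {M : Type*} [MonoidWithZero M] {a b : M} (h₁ : a * b = 1)
    (h₂ : b * a = 1) : Ring.inverse a = b :=
  Ring.inverse_unit ⟨a, b, h₁, h₂⟩

/-- Evaluation commutes with homomorphisms of algebras. -/
theorem evalHom_comp {B B' : Type*} [Ring B] [Algebra K B] [Ring B'] [Algebra K B']
    (φ : MultiWord d l →* B) (φ' : MultiWord d l →* B') (f : B →ₐ[K] B')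
    (hf : ∀ w, f (φ w) = φ' w) {p q : ℕ} (R : Expr K d l p q) :
    DomHom φ R → DomHom φ' R ∧ evalHom φ' R = (evalHom φ R).map f := by
  induction R with
  | poly P =>
    refine fun _ => ⟨trivial, ?_⟩
    ext1 a b
    simp [evalHom, Finsupp.sum, hf]
  | add R S hR hS =>
    rintro ⟨h₁, h₂⟩
    refine ⟨⟨(hR h₁).1, (hS h₂).1⟩, ?_⟩
    ext1 a b
    simp [evalHom, (hR h₁).2, (hS h₂).2]
  | mul R S hR hS =>
    rintro ⟨h₁, h₂⟩
    refine ⟨⟨(hR h₁).1, (hS h₂).1⟩, ?_⟩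
    simp only [evalHom, (hR h₁).2, (hS h₂).2, Matrix.map_mul]
  | inv R hR =>
    rintro ⟨h₁, h₂⟩
    -- Matrices over `B` are mapped by an algebra homomorphism, which preserves units and inverses;
    -- this is why the domain is only transported forwards.
    have e : evalHom φ' R = f.mapMatrix (evalHom φ R) := (hR h₁).2
    refine ⟨⟨(hR h₁).1, e ▸ h₂.map f.mapMatrix⟩, ?_⟩
    refine ringInverse_eq_of_mul_eq_one (b := f.mapMatrix (Ring.inverse (evalHom φ R))) ?_ ?_
    · rw [e, ← map_mul, Ring.mul_inverse_cancel _ h₂, map_one]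
    · rw [e, ← map_mul, Ring.inverse_mul_cancel _ h₂, map_one]
  | block R hR =>
    intro h
    refine ⟨fun a b => (hR a b (h a b)).1, ?_⟩
    ext1 a b
    simp only [evalHom, Matrix.of_apply, Matrix.map_apply, (hR _ _ (h _ _)).2]

/-- `insertTuple` at the level of words. -/
def insertWord (d : ℕ) {l : ℕ} (k : Fin (l + 1)) : MultiWord d l →* MultiWord d (l + 1) where
  toFun w := k.insertNth (α := fun _ => FreeMonoid (Fin d)) 1 w
  map_one' := by
    funext m
    rcases Fin.eq_self_or_eq_succAbove k m with rfl | ⟨m, rfl⟩ <;> simp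
  map_mul' v w := by
    funext m
    rcases Fin.eq_self_or_eq_succAbove k m with rfl | ⟨m, rfl⟩ <;> simp

/-- Both sides carry out the same computation, and `Ring.inverse` is total, so no domain hypothesis
is needed. -/
theorem evalHom_insertTuple {B : Type*} [Ring B] [Algebra K B] (k : Fin (l + 1))
    (φ : MultiWord d (l + 1) →* B) {p q : ℕ} (R : Expr K d l p q) :
    evalHom φ (insertTuple k R) = evalHom (φ.comp (insertWord d k)) R := by
  induction R with
  | poly P =>
    ext1 a b
    simp only [insertTuple, evalHom, Matrix.of_apply]
    rw [Finsupp.sum_mapDomain_index (by simp) (by intros; simp [add_smul])]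
    rfl
  | add R S hR hS => simp only [insertTuple, evalHom, hR, hS]
  | mul R S hR hS => simp only [insertTuple, evalHom, hR, hS]
  | inv R hR => simp only [insertTuple, evalHom, hR]
  | block R hR => simp only [insertTuple, evalHom, hR]

theorem domHom_insertTuple {B : Type*} [Ring B] [Algebra K B] (k : Fin (l + 1))
    (φ : MultiWord d (l + 1) →* B) {p q : ℕ} (R : Expr K d l p q) :
    DomHom φ (insertTuple k R) ↔ DomHom (φ.comp (insertWord d k)) R := by
  induction R with
  | poly P => exact Iff.rfl
  | add R S hR hS => simp only [insertTuple, DomHom, hR, hS]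
  | mul R S hR hS => simp only [insertTuple, DomHom, hR, hS]
  | inv R hR => simp only [insertTuple, DomHom, hR, evalHom_insertTuple]
  | block R hR => simp only [insertTuple, DomHom, hR]

end Expr

/-! ### Kronecker products -/

/-- The Kronecker product of a finite family of square matrices. -/
def piKron {ι A : Type*} [Fintype ι] [CommRing A] {n : ι → Type*}
    (M : ∀ k, Matrix (n k) (n k) A) : Matrix (∀ k, n k) (∀ k, n k) A :=
  Matrix.of fun i j => ∏ k, M k (i k) (j k)

/-- The Kronecker product as a multiplicative map. -/
def piKronHom {ι A : Type*} [Fintype ι] [DecidableEq ι] [CommRing A] (n : ι → Type*)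
    [∀ k, Fintype (n k)] [∀ k, DecidableEq (n k)] :
    (∀ k, Matrix (n k) (n k) A) →* Matrix (∀ k, n k) (∀ k, n k) A where
  toFun := piKron
  map_one' := by
    ext i j
    by_cases h : i = j
    · subst h; simp [piKron]
    · obtain ⟨k, hk⟩ := Function.ne_iff.mp h
      rw [Matrix.one_apply_ne h]
      exact Finset.prod_eq_zero (Finset.mem_univ k) (Matrix.one_apply_ne hk)
  map_mul' M N := by
    ext i j
    simp only [piKron, Matrix.of_apply, Matrix.mul_apply, Pi.mul_apply]
    rw [Fintype.prod_sum]
    exact Finset.sum_congr rfl fun _ _ => Finset.prod_mul_distrib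

/-- The homomorphism `w ↦ (Z⁽¹⁾)^{w₁} ⊗ ⋯ ⊗ (Z⁽ˡ⁾)^{wₗ}` for matrices `Z⁽ᵏ⁾_j = m k j` over a
commutative ring. -/
noncomputable def tensorHom {A : Type*} [CommRing A] {d l : ℕ} {n : Fin l → Type*}
    [∀ k, Fintype (n k)] [∀ k, DecidableEq (n k)] (m : ∀ k, Fin d → Matrix (n k) (n k) A) :
    MultiWord d l →* Matrix (∀ k, n k) (∀ k, n k) A :=
  (piKronHom n).comp (MonoidHom.pi fun k => (FreeMonoid.lift (m k)).comp (Pi.evalMonoidHom _ k))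

theorem tensorHom_apply {A : Type*} [CommRing A] {d l : ℕ} {n : Fin l → Type*}
    [∀ k, Fintype (n k)] [∀ k, DecidableEq (n k)] (m : ∀ k, Fin d → Matrix (n k) (n k) A)
    (w : MultiWord d l) (a b : ∀ k, n k) :
    tensorHom m w a b = ∏ k, FreeMonoid.lift (m k) (w k) (a k) (b k) := rfl

theorem tensorHom_mulSingle {A : Type*} [CommRing A] {d l : ℕ} {n : Fin l → Type*}
    [∀ k, Fintype (n k)] [∀ k, DecidableEq (n k)] (m : ∀ k, Fin d → Matrix (n k) (n k) A)
    (k : Fin l) (j : Fin d) (a b : ∀ k, n k) :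
    tensorHom m (Pi.mulSingle k (FreeMonoid.of j)) a b =
      if ∀ r, r ≠ k → a r = b r then m k j (a k) (b k) else 0 := by
  rw [tensorHom_apply, ← Finset.mul_prod_erase _ _ (Finset.mem_univ k)]
  simp only [Pi.mulSingle_eq_same, FreeMonoid.lift_eval_of]
  split_ifs with h
  · rw [Finset.prod_eq_one, mul_one]
    intro r hr
    have hr' := Finset.ne_of_mem_erase hr
    rw [Pi.mulSingle_eq_of_ne hr', map_one, h r hr', Matrix.one_apply_eq]
  · push Not at h
    obtain ⟨r, hr, hne⟩ := h
    rw [Finset.prod_eq_zero (i := r), mul_zero]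
    · simp [hr]
    · rw [Pi.mulSingle_eq_of_ne hr, map_one, Matrix.one_apply_ne hne]

/-- Multiwords are generated by single letters placed in one coordinate. All later identities
between evaluation homomorphisms are checked on these letters, where `tensorHom_mulSingle` gives the
entries. -/
theorem multiWord_hom_ext {M : Type*} [Monoid M] {d l : ℕ} {f g : MultiWord d l →* M}
    (h : ∀ k j, f (Pi.mulSingle k (FreeMonoid.of j)) = g (Pi.mulSingle k (FreeMonoid.of j))) :
    f = g := by
  refine MonoidHom.pi_ext fun k w => ?_
  have : f.comp (MonoidHom.mulSingle (fun _ => FreeMonoid (Fin d)) k) =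
      g.comp (MonoidHom.mulSingle (fun _ => FreeMonoid (Fin d)) k) :=
    FreeMonoid.hom_eq (h k)
  exact DFunLike.congr_fun this w

/-! ### Matrix points as monoid homomorphisms -/

section Points

variable {K : Type u} [Field K] {d l : ℕ}

/-- `kron x` as a homomorphism -/
noncomputable def kronHom (x : Point K d l) : MultiWord d l →* TensorMat x :=
  tensorHom fun k => (x k).mat

theorem Expr.eval_eq_evalHom (x : Point K d l) {p q : ℕ} (R : Expr K d l p q) :
    eval x R = evalHom (kronHom x) R := by
  induction R with
  | poly P => rfl
  | add R S hR hS => simp only [eval, evalHom, hR, hS]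
  | mul R S hR hS => simp only [eval, evalHom, hR, hS]
  | inv R hR => simp only [eval, evalHom, hR]
  | block R hR => simp only [eval, evalHom, hR]

theorem Expr.dom_iff_domHom (x : Point K d l) {p q : ℕ} (R : Expr K d l p q) :
    Dom x R ↔ DomHom (kronHom x) R := by
  induction R with
  | poly P => exact Iff.rfl
  | add R S hR hS => simp only [Dom, DomHom, hR, hS]
  | mul R S hR hS => simp only [Dom, DomHom, hR, hS]
  | inv R hR => simp only [Dom, DomHom, hR, eval_eq_evalHom]
  | block R hR => simp only [Dom, DomHom, hR]

end Points

/-- `A ↦ A ⊗ 1`, for an index set `I` identified with a product. -/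
def amp (K : Type*) {A I J E : Type*} [CommRing K] [Ring A] [Algebra K A] [Fintype I]
    [DecidableEq I] [Fintype J] [DecidableEq J] [Fintype E] [DecidableEq E] (e : I ≃ J × E) :
    Matrix J J A →ₐ[K] Matrix I I A where
  toFun M := Matrix.of fun i i' => if (e i).2 = (e i').2 then M (e i).1 (e i').1 else 0
  map_one' := by
    ext i j
    by_cases h : i = j
    · subst h; simp
    · rw [Matrix.one_apply_ne h, Matrix.of_apply]
      split_ifs with hk
      · exact Matrix.one_apply_ne fun h' => h (e.injective (Prod.ext h' hk))
      · rfl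
  map_mul' M N := by
    ext i j
    rw [Matrix.mul_apply, ← e.symm.sum_comp, Fintype.sum_prod_type]
    simp [Matrix.mul_apply]
  map_zero' := by ext; simp
  map_add' M N := by
    ext i j
    simp only [Matrix.of_apply, Matrix.add_apply]
    split_ifs <;> simp
  commutes' c := by
    ext i j
    simp only [Matrix.algebraMap_matrix_apply, Matrix.of_apply]
    by_cases h : i = j
    · subst h; simp
    · rw [if_neg h]
      split_ifs with hk h'
      · exact absurd (e.injective (Prod.ext h' hk)) h
      · rfl
      · rfl

theorem amp_apply (K : Type*) {A I J E : Type*} [CommRing K] [Ring A] [Algebra K A] [Fintype I]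
    [DecidableEq I] [Fintype J] [DecidableEq J] [Fintype E] [DecidableEq E] (e : I ≃ J × E)
    (M : Matrix J J A) (i i' : I) :
    amp K e M i i' = if (e i).2 = (e i').2 then M (e i).1 (e i').1 else 0 := rfl

theorem amp_injective (K : Type*) {A I J E : Type*} [CommRing K] [Ring A] [Algebra K A]
    [Fintype I] [DecidableEq I] [Fintype J] [DecidableEq J] [Fintype E] [DecidableEq E]
    [Nonempty E] (e : I ≃ J × E) : Function.Injective (amp (A := A) K e) := by
  intro M N h
  ext i j
  obtain ⟨c⟩ := ‹Nonempty E›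
  simpa [amp_apply] using congrFun (congrFun h (e.symm (i, c))) (e.symm (j, c))

/-! ### The difference-differential operators and block triangular matrices -/

/-- the multiword `(w₁, …, wₗ, u, v)` -/
def snocWord (d l : ℕ) :
    MultiWord d l × FreeMonoid (Fin d) × FreeMonoid (Fin d) →* MultiWord d (l + 2) where
  toFun w := Fin.snoc (α := fun _ => FreeMonoid (Fin d))
    (Fin.snoc (α := fun _ => FreeMonoid (Fin d)) w.1 w.2.1) w.2.2
  map_one' := by
    funext m
    refine Fin.lastCases ?_ (fun m => Fin.lastCases ?_ (fun m => ?_) m) m <;> simp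
  map_mul' v w := by
    funext m
    refine Fin.lastCases ?_ (fun m => Fin.lastCases ?_ (fun m => ?_) m) m <;> simp

@[simp] theorem snocWord_last {d l : ℕ}
    (w : MultiWord d l × FreeMonoid (Fin d) × FreeMonoid (Fin d)) :
    snocWord d l w (Fin.last _) = w.2.2 := by simp [snocWord]

@[simp] theorem snocWord_castSucc_last {d l : ℕ}
    (w : MultiWord d l × FreeMonoid (Fin d) × FreeMonoid (Fin d)) :
    snocWord d l w (Fin.last _).castSucc = w.2.1 := by
  simp [snocWord]

@[simp] theorem snocWord_castSucc_castSucc {d l : ℕ}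
    (w : MultiWord d l × FreeMonoid (Fin d) × FreeMonoid (Fin d)) (m : Fin l) :
    snocWord d l w m.castSucc.castSucc = w.1 m := by simp [snocWord]

theorem insertWord_last {d l : ℕ} (w : MultiWord d (l + 1)) :
    Expr.insertWord d (Fin.last (l + 1)) w = snocWord d l (Fin.init w, w (Fin.last l), 1) := by
  funext m
  refine Fin.lastCases ?_ (fun m => Fin.lastCases ?_ (fun m => ?_) m) m
  · simp [Expr.insertWord]
  · rw [snocWord_castSucc_last]
    simp [Expr.insertWord, Fin.insertNth_last']
  · rw [snocWord_castSucc_castSucc]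
    simp [Expr.insertWord, Fin.insertNth_last', Fin.init]

theorem insertWord_castSucc_last {d l : ℕ} (w : MultiWord d (l + 1)) :
    Expr.insertWord d (Fin.last l).castSucc w = snocWord d l (Fin.init w, 1, w (Fin.last l)) := by
  funext m
  rcases Fin.eq_self_or_eq_succAbove (Fin.last l).castSucc m with rfl | ⟨m, rfl⟩
  · rw [snocWord_castSucc_last]
    simp [Expr.insertWord]
  · simp only [Expr.insertWord, MonoidHom.coe_mk, OneHom.coe_mk, Fin.insertNth_apply_succAbove]
    refine Fin.lastCases ?_ (fun m => ?_) m
    · rw [Fin.succAbove_castSucc_self, Fin.succ_last, snocWord_last]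
    · rw [Fin.succAbove_of_castSucc_lt _ _ (by simp [Fin.lt_def]), snocWord_castSucc_castSucc]
      rfl

/-! ### The Leibniz rule for splittings of words -/

/-- `∑_{w = u g_j v} α(u) β(v)` -/
def splitSum {B : Type*} [Ring B] {d : ℕ} (j : Fin d) (α β : FreeMonoid (Fin d) →* B)
    (w : FreeMonoid (Fin d)) : B :=
  ∑ i : Fin w.toList.length, if w.toList.get i = j then
    α (FreeMonoid.ofList (w.toList.take i)) * β (FreeMonoid.ofList (w.toList.drop (i + 1))) else 0

theorem splitSum_one {B : Type*} [Ring B] {d : ℕ} (j : Fin d) (α β : FreeMonoid (Fin d) →* B) :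
    splitSum j α β 1 = 0 :=
  Finset.sum_of_isEmpty (ι := Fin 0) _

theorem splitSum_of_mul {B : Type*} [Ring B] {d : ℕ} (j : Fin d) (α β : FreeMonoid (Fin d) →* B)
    (i : Fin d) (w : FreeMonoid (Fin d)) :
    splitSum j α β (FreeMonoid.of i * w) =
      (if i = j then β w else 0) + α (FreeMonoid.of i) * splitSum j α β w := by
  have h := Fin.sum_univ_succ (n := w.toList.length) fun k =>
    if (i :: w.toList).get k = j then
      α (FreeMonoid.ofList ((i :: w.toList).take k)) *
        β (FreeMonoid.ofList ((i :: w.toList).drop (k + 1))) else 0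
  refine h.trans ?_
  simp only [splitSum, Finset.mul_sum]
  congr 1
  · simp
  · refine Finset.sum_congr rfl fun k _ => ?_
    simp [FreeMonoid.ofList_cons, mul_assoc]

/-- The marked letter g_j lies either in w or in v. -/
theorem splitSum_mul {B : Type*} [Ring B] {d : ℕ} (j : Fin d) (α β : FreeMonoid (Fin d) →* B)
    (v w : FreeMonoid (Fin d)) :
    splitSum j α β (v * w) = α v * splitSum j α β w + splitSum j α β v * β w := by
  induction v using FreeMonoid.inductionOn' with
  | one => rw [splitSum_one, one_mul, map_one, one_mul, zero_mul, add_zero]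
  | of_mul i v ih =>
    rw [mul_assoc, splitSum_of_mul, splitSum_of_mul, ih, map_mul, map_mul]
    split_ifs <;> noncomm_ring

theorem commute_splitSum {B : Type*} [Ring B] {d : ℕ} (j : Fin d) (α β : FreeMonoid (Fin d) →* B)
    (b : B) (hα : ∀ u, Commute b (α u)) (hβ : ∀ u, Commute b (β u)) (w : FreeMonoid (Fin d)) :
    Commute b (splitSum j α β w) :=
  Commute.sum_right _ _ _ fun i _ => by
    split_ifs
    · exact (hα _).mul_right (hβ _)
    · exact Commute.zero_right _

section Triangular

variable {B : Type*} [Ring B] {d l : ℕ}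

/-- `∑_{wₗ = u g_j v} φ(w₁, …, wₗ₋₁, u, v)` -/
def derivWord (j : Fin d) (φ : MultiWord d (l + 2) →* B) (w : MultiWord d (l + 1)) : B :=
  ∑ i : Fin (w (Fin.last l)).toList.length,
    if (w (Fin.last l)).toList.get i = j then
      φ (snocWord d l (Fin.init w, FreeMonoid.ofList ((w (Fin.last l)).toList.take i),
        FreeMonoid.ofList ((w (Fin.last l)).toList.drop (i + 1)))) else 0

theorem map_snocWord (φ : MultiWord d (l + 2) →* B) (w : MultiWord d l)
    (u v : FreeMonoid (Fin d)) :
    φ (snocWord d l (w, u, v)) =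
      φ (snocWord d l (w, 1, 1)) * (φ (snocWord d l (1, u, 1)) * φ (snocWord d l (1, 1, v))) := by
  simp [← map_mul]

/-- The coordinates before the last are untouched by Δ_j and factor out, leaving a splitting sum of
a single word. -/
theorem derivWord_eq (j : Fin d) (φ : MultiWord d (l + 2) →* B) (w : MultiWord d (l + 1)) :
    derivWord j φ w = φ (snocWord d l (Fin.init w, 1, 1)) *
      splitSum j
        (φ.comp ((snocWord d l).comp ((MonoidHom.inr _ _).comp (MonoidHom.inl _ _))))
        (φ.comp ((snocWord d l).comp ((MonoidHom.inr _ _).comp (MonoidHom.inr _ _))))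
        (w (Fin.last l)) := by
  rw [derivWord, splitSum, Finset.mul_sum]
  refine Finset.sum_congr rfl fun i _ => ?_
  rw [mul_ite, mul_zero, map_snocWord]
  rfl

/-- The Leibniz rule of `splitSum_mul`, once the factors belonging to different coordinates have
been commuted past each other. It is what makes `triHom` multiplicative. -/
theorem derivWord_mul (j : Fin d) (φ : MultiWord d (l + 2) →* B) (v w : MultiWord d (l + 1)) :
    derivWord j φ (v * w) =
      φ (Expr.insertWord d (Fin.last (l + 1)) v) * derivWord j φ w +
        derivWord j φ v * φ (Expr.insertWord d (Fin.last l).castSucc w) := by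
  have hinit : (Fin.init (v * w) : MultiWord d l) = Fin.init v * Fin.init w := rfl
  have hc : ∀ u s, Commute (φ (snocWord d l (Fin.init w, 1, 1))) (φ (snocWord d l (1, u, s))) :=
    fun u s => by simp [Commute, SemiconjBy, ← map_mul]
  have hs := commute_splitSum j
    (φ.comp ((snocWord d l).comp ((MonoidHom.inr _ _).comp (MonoidHom.inl _ _))))
    (φ.comp ((snocWord d l).comp ((MonoidHom.inr _ _).comp (MonoidHom.inr _ _))))
    (φ (snocWord d l (Fin.init w, 1, 1))) (fun u => hc u 1) (fun u => hc 1 u)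
    (v (Fin.last l))
  have h₁ := hc (v (Fin.last l)) 1
  rw [derivWord_eq, derivWord_eq, derivWord_eq, insertWord_last, insertWord_castSucc_last,
    map_snocWord φ (Fin.init v) (v (Fin.last l)) 1,
    map_snocWord φ (Fin.init w) 1 (w (Fin.last l)), Pi.mul_apply, splitSum_mul, hinit]
  have e : φ (snocWord d l (Fin.init v * Fin.init w, 1, 1)) =
      φ (snocWord d l (Fin.init v, 1, 1)) * φ (snocWord d l (Fin.init w, 1, 1)) := by
    simp [← map_mul]
  have e1 : φ (snocWord d l (1, 1, 1)) = 1 := by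
    rw [← map_one φ, ← map_one (snocWord d l)]; rfl
  rw [e, e1, mul_add]
  simp only [Commute, SemiconjBy] at hs h₁
  congr 1
  · simp only [MonoidHom.comp_apply, MonoidHom.inr_apply, MonoidHom.inl_apply, mul_assoc,
      mul_one]
    rw [← mul_assoc (φ (snocWord d l (Fin.init w, 1, 1))) (φ (snocWord d l (1, _, 1))), h₁]
    simp only [mul_assoc]
  · simp only [mul_assoc]
    rw [← mul_assoc (φ (snocWord d l (Fin.init w, 1, 1))), hs]
    simp only [mul_assoc, one_mul]
    rfl

/-- The homomorphism `w ↦ [φ(w ⊗ 1), φ(Δ_j w); 0, φ(ι w)]` to block triangular matrices. -/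
def triHom (j : Fin d) (φ : MultiWord d (l + 2) →* B) :
    MultiWord d (l + 1) →* Matrix (Fin 2) (Fin 2) B where
  toFun w := !![φ (Expr.insertWord d (Fin.last (l + 1)) w), derivWord j φ w;
    0, φ (Expr.insertWord d (Fin.last l).castSucc w)]
  map_one' := by
    rw [map_one, map_one, map_one, map_one, Matrix.one_fin_two]
    rw [derivWord_eq, Pi.one_apply, splitSum_one, mul_zero]
  map_mul' v w := by
    simp [derivWord_mul]

theorem triHom_apply (j : Fin d) (φ : MultiWord d (l + 2) →* B) (w : MultiWord d (l + 1)) :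
    triHom j φ w = !![φ (Expr.insertWord d (Fin.last (l + 1)) w), derivWord j φ w;
      0, φ (Expr.insertWord d (Fin.last l).castSucc w)] := rfl

/-- The matrix with the entries `[A, D; 0, C]`. -/
def triMatrix {p q : ℕ} (A D C : Matrix (Fin p) (Fin q) B) :
    Matrix (Fin p) (Fin q) (Matrix (Fin 2) (Fin 2) B) :=
  Matrix.of fun a b => !![A a b, D a b; 0, C a b]

theorem triMatrix_mul {p q r : ℕ} (A D C : Matrix (Fin p) (Fin q) B)
    (A' D' C' : Matrix (Fin q) (Fin r) B) :
    triMatrix A D C * triMatrix A' D' C' =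
      triMatrix (A * A') (D * C' + A * D') (C * C') := by
  ext a b i j
  rw [Matrix.mul_apply, Matrix.sum_apply]
  fin_cases i <;> fin_cases j <;>
    simp [triMatrix, Matrix.mul_apply, Finset.sum_add_distrib, add_comm]

theorem triMatrix_one {p : ℕ} :
    triMatrix (1 : Matrix (Fin p) (Fin p) B) 0 1 = 1 := by
  ext1 a b
  by_cases h : a = b
  · subst h; simp [triMatrix, Matrix.one_fin_two]
  · ext i j
    fin_cases i <;> fin_cases j <;> simp [triMatrix, Matrix.one_apply_ne h]

end Triangular

/-! ### Expressions along the triangular homomorphism -/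

namespace Expr

variable {K : Type u} [Field K] {B : Type*} [Ring B] [Algebra K B] {d l : ℕ}

theorem evalHom_const (φ : MultiWord d l →* B) {p : ℕ} :
    evalHom φ (const (-1 : Matrix (Fin p) (Fin p) K)) = -1 := by
  ext a b
  simp only [const, evalHom, Matrix.of_apply]
  rw [Finsupp.sum_single_index (by simp), map_one]
  by_cases h : a = b
  · subst h; simp
  · simp [Matrix.one_apply_ne h]

/-- Every inverse taken in R reappears in Δ_j(R), both in the form R⁻¹ ⊗ 1 and in the form ι(R⁻¹).
-/
theorem domHom_of_delta (j : Fin d) (φ : MultiWord d (l + 2) →* B) {p q : ℕ}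
    (R : Expr K d (l + 1) p q) :
    DomHom φ (delta j R) → DomHom φ (tensorOne R) ∧ DomHom φ (iota R) := by
  induction R with
  | poly P => exact fun _ => ⟨trivial, trivial⟩
  | add R S hR hS => exact fun h => ⟨⟨(hR h.1).1, (hS h.2).1⟩, ⟨(hR h.1).2, (hS h.2).2⟩⟩
  | mul R S hR hS =>
    exact fun h => ⟨⟨(hR h.1.1).1, (hS h.2.2).1⟩, ⟨(hR h.1.1).2, (hS h.2.2).2⟩⟩
  | inv R hR => exact fun h => ⟨h.2.1.1, h.2.2⟩
  | block R hR => exact fun h => ⟨fun a b => (hR a b (h a b)).1, fun a b => (hR a b (h a b)).2⟩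

/-- The value of `R` at `triHom` consists of the values of `R ⊗ 1`, `Δ_j(R)` and `ι(R)`. -/
theorem evalHom_triHom (j : Fin d) (φ : MultiWord d (l + 2) →* B) {p q : ℕ}
    (R : Expr K d (l + 1) p q) :
    DomHom φ (tensorOne R) → DomHom φ (iota R) →
      DomHom φ (delta j R) ∧ DomHom (triHom j φ) R ∧
        evalHom (triHom j φ) R =
          triMatrix (evalHom φ (tensorOne R)) (evalHom φ (delta j R)) (evalHom φ (iota R)) := by
  induction R with
  | poly P =>
    refine fun _ _ => ⟨trivial, trivial, ?_⟩
    ext1 a b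
    have h₁ : evalHom φ (tensorOne (poly P)) a b =
        ∑ w ∈ P.support, P w a b • φ (insertWord d (Fin.last (l + 1)) w) := by
      rw [tensorOne, evalHom_insertTuple]; rfl
    have h₂ : evalHom φ (iota (poly P)) a b =
        ∑ w ∈ P.support, P w a b • φ (insertWord d (Fin.last l).castSucc w) := by
      rw [iota, evalHom_insertTuple]; rfl
    have h₃ : evalHom φ (delta j (poly P)) a b =
        ∑ w ∈ P.support, P w a b • derivWord j φ w := by
      simp only [delta, deltaPoly, evalHom, Matrix.of_apply]
      rw [Finsupp.sum_sum_index (by simp) (by intros; simp [add_smul])]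
      refine Finset.sum_congr rfl fun w _ => ?_
      refine (Finsupp.sum_finsetSum_index (h := fun w (A : Matrix _ _ K) => A a b • φ w)
        (by simp) (by intros; simp [add_smul])).symm.trans ?_
      rw [derivWord, Finset.smul_sum]
      refine Finset.sum_congr rfl fun i _ => ?_
      split_ifs
      · rw [Finsupp.sum_single_index (by simp)]
        rfl
      · simp
    have h₄ : evalHom (triHom j φ) (poly P) a b = ∑ w ∈ P.support, P w a b • triHom j φ w := rfl
    rw [triMatrix, Matrix.of_apply, h₁, h₂, h₃, h₄]
    ext i i'
    rw [Matrix.sum_apply]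
    fin_cases i <;> fin_cases i' <;> simp [triHom_apply]
  | add R S hR hS =>
    rintro ⟨h₁, h₂⟩ ⟨h₃, h₄⟩
    obtain ⟨r₁, r₂, r₃⟩ := hR h₁ h₃
    obtain ⟨s₁, s₂, s₃⟩ := hS h₂ h₄
    refine ⟨⟨r₁, s₁⟩, ⟨r₂, s₂⟩, ?_⟩
    simp only [tensorOne, iota, insertTuple, delta, evalHom] at r₃ s₃ ⊢
    rw [r₃, s₃]
    ext a b i i'
    fin_cases i <;> fin_cases i' <;> simp [triMatrix]
  | mul R S hR hS =>
    rintro ⟨h₁, h₂⟩ ⟨h₃, h₄⟩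
    obtain ⟨r₁, r₂, r₃⟩ := hR h₁ h₃
    obtain ⟨s₁, s₂, s₃⟩ := hS h₂ h₄
    refine ⟨⟨⟨r₁, h₄⟩, ⟨h₁, s₁⟩⟩, ⟨r₂, s₂⟩, ?_⟩
    simp only [tensorOne, iota, insertTuple, delta, evalHom] at r₃ s₃ ⊢
    rw [r₃, s₃, triMatrix_mul]
  | inv R hR =>
    rintro ⟨h₁, h₂⟩ ⟨h₃, h₄⟩
    obtain ⟨r₁, r₂, r₃⟩ := hR h₁ h₃
    have e : evalHom φ (delta j (inv R)) =
        -(Ring.inverse (evalHom φ (tensorOne R)) * evalHom φ (delta j R) *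
          Ring.inverse (evalHom φ (iota R))) := by
      simp only [delta, evalHom, evalHom_const, tensorOne, iota, insertTuple, neg_mul, one_mul]
    have e₁ : evalHom φ (tensorOne (inv R)) = Ring.inverse (evalHom φ (tensorOne R)) := rfl
    have e₂ : evalHom φ (iota (inv R)) = Ring.inverse (evalHom φ (iota R)) := rfl
    have i₁ := Ring.mul_inverse_cancel _ h₂
    have i₂ := Ring.inverse_mul_cancel _ h₂
    have i₃ := Ring.mul_inverse_cancel _ h₄
    have i₄ := Ring.inverse_mul_cancel _ h₄
    change evalHom φ (tensorOne R) * Ring.inverse (evalHom φ (tensorOne R)) = 1 at i₁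
    change Ring.inverse (evalHom φ (tensorOne R)) * evalHom φ (tensorOne R) = 1 at i₂
    change evalHom φ (iota R) * Ring.inverse (evalHom φ (iota R)) = 1 at i₃
    change Ring.inverse (evalHom φ (iota R)) * evalHom φ (iota R) = 1 at i₄
    -- The inverse of [A, D; 0, C] is [A⁻¹, −A⁻¹DC⁻¹; 0, C⁻¹], and its corner is the rule for
    -- Δ_j(R⁻¹).
    have m₁ : evalHom (triHom j φ) R * triMatrix (evalHom φ (tensorOne (inv R)))
        (evalHom φ (delta j (inv R))) (evalHom φ (iota (inv R))) = 1 := by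
      rw [r₃, triMatrix_mul, e, e₁, e₂, i₁, i₃, mul_neg, ← mul_assoc, ← mul_assoc, i₁, one_mul,
        add_neg_cancel, triMatrix_one]
    have m₂ : triMatrix (evalHom φ (tensorOne (inv R)))
        (evalHom φ (delta j (inv R))) (evalHom φ (iota (inv R))) * evalHom (triHom j φ) R = 1 := by
      rw [r₃, triMatrix_mul, e, e₁, e₂, i₂, i₄, neg_mul, mul_assoc, i₄, mul_one,
        neg_add_cancel, triMatrix_one]
    refine ⟨⟨trivial, ⟨⟨h₁, h₂⟩, r₁⟩, ⟨h₃, h₄⟩⟩, ⟨r₂, ⟨⟨_, _, m₁, m₂⟩, rfl⟩⟩, ?_⟩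
    exact ringInverse_eq_of_mul_eq_one m₁ m₂
  | block R hR =>
    intro h₁ h₃
    have H := fun a b => hR a b (h₁ a b) (h₃ a b)
    refine ⟨fun a b => (H a b).1, fun a b => (H a b).2.1, ?_⟩
    ext1 a b
    have := fun a b => (H a b).2.2
    simp only [tensorOne, iota, insertTuple, delta, evalHom, triMatrix] at this ⊢
    simp only [this, Matrix.of_apply]

end Expr

/-! ### The difference-differential operators on functions -/

theorem insertWord_mulSingle {d l : ℕ} (k : Fin (l + 1)) (m : Fin l) (u : FreeMonoid (Fin d)) :
    Expr.insertWord d k (Pi.mulSingle m u) = Pi.mulSingle (k.succAbove m) u := by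
  funext r
  rcases Fin.eq_self_or_eq_succAbove k r with rfl | ⟨r, rfl⟩
  · simp [Expr.insertWord]
  · by_cases h : r = m
    · subst h; simp [Expr.insertWord]
    · simp [Expr.insertWord, Pi.mulSingle_eq_of_ne h,
        Pi.mulSingle_eq_of_ne (fun h' => h (Fin.succAbove_right_injective h') :
          k.succAbove r ≠ k.succAbove m)]

theorem derivWord_mulSingle_castSucc {B : Type*} [Ring B] {d l : ℕ} (j : Fin d)
    (φ : MultiWord d (l + 2) →* B) (k : Fin l) (u : FreeMonoid (Fin d)) :
    derivWord j φ (Pi.mulSingle k.castSucc u) = 0 := by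
  rw [derivWord_eq, Pi.mulSingle_eq_of_ne (Fin.castSucc_ne_last k).symm, splitSum_one, mul_zero]

theorem derivWord_mulSingle_last {B : Type*} [Ring B] {d l : ℕ} (j : Fin d)
    (φ : MultiWord d (l + 2) →* B) (i : Fin d) :
    derivWord j φ (Pi.mulSingle (Fin.last l) (FreeMonoid.of i)) = if i = j then 1 else 0 := by
  have h : (Fin.init (Pi.mulSingle (Fin.last l) (FreeMonoid.of i) : MultiWord d (l + 1)) :
      MultiWord d l) = 1 := by
    funext k
    simp [Fin.init]
  have e1 : snocWord d l (1, 1, 1) = 1 := map_one (snocWord d l)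
  rw [derivWord_eq, h, e1, Pi.mulSingle_eq_same, ← mul_one (FreeMonoid.of i), splitSum_of_mul,
    splitSum_one]
  simp [e1]

theorem matrix_of_two_apply {A I : Type*} [Zero A] (P D N Q : Matrix I I A) (s t : Fin 2) (a b : I) :
    (!![P, D; N, Q] : Matrix (Fin 2) (Fin 2) (Matrix I I A)) s t a b =
      !![P a b, D a b; N a b, Q a b] s t := by
  fin_cases s <;> fin_cases t <;> rfl

/-! ### A matrix point realising the triangular homomorphism -/

section TriPoint

variable {K : Type u} [Field K] {d l : ℕ}

/-- The point `(Z⁽¹⁾, …, Z⁽ˡ⁾, [Z⁽ˡ⁺¹⁾ ⊗ 1, δ_j; 0, 1 ⊗ Z⁽ˡ⁺²⁾])`, where the first `l` entries are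
enlarged to `Z⁽ᵏ⁾ ⊗ 1`. -/
def triPoint (j : Fin d) (x : Point K d (l + 2)) : Point K d (l + 1) := fun k =>
  -- One formula for the index type serves all k, so the sizes involve no case distinction. For k
  -- before the last the extra factor only amplifies.
  { n := (x k.castSucc).n × Fin 2 × (x (Fin.last (l + 1))).n
    mat := fun i => Matrix.of fun a b =>
      if k = Fin.last l then
        !![if a.2.2 = b.2.2 then (x k.castSucc).mat i a.1 b.1 else 0,
          if i = j ∧ a.1 = b.1 ∧ a.2.2 = b.2.2 then 1 else 0;
          0, if a.1 = b.1 then (x (Fin.last (l + 1))).mat i a.2.2 b.2.2 else 0] a.2.1 b.2.1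
      else if a.2 = b.2 then (x k.castSucc).mat i a.1 b.1 else 0 }

theorem triPoint_mat_last (j : Fin d) (x : Point K d (l + 2)) (i : Fin d)
    (a b : (triPoint j x (Fin.last l)).n) :
    (triPoint j x (Fin.last l)).mat i a b =
      !![if a.2.2 = b.2.2 then (x (Fin.last l).castSucc).mat i a.1 b.1 else 0,
        if i = j ∧ a.1 = b.1 ∧ a.2.2 = b.2.2 then 1 else 0;
        0, if a.1 = b.1 then (x (Fin.last (l + 1))).mat i a.2.2 b.2.2 else 0] a.2.1 b.2.1 :=
  if_pos rfl

theorem triPoint_mat_castSucc (j : Fin d) (x : Point K d (l + 2)) (k : Fin l) (i : Fin d)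
    (a b : (triPoint j x k.castSucc).n) :
    (triPoint j x k.castSucc).mat i a b =
      if a.2 = b.2 then (x k.castSucc.castSucc).mat i a.1 b.1 else 0 :=
  if_neg (Fin.castSucc_ne_last k)

/-- The identification of the index set of `triPoint`. -/
def triEquiv (j : Fin d) (x : Point K d (l + 2)) :
    Idx (triPoint j x) ≃ (Fin 2 × Idx x) × (Fin l → Fin 2 × (x (Fin.last (l + 1))).n) where
  toFun i := (((i (Fin.last l)).2.1,
    Fin.snoc (α := fun k => (x k).n) (fun k => (i k).1) (i (Fin.last l)).2.2),
    fun k => (i k.castSucc).2)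
  invFun a := fun k => (a.1.2 k.castSucc,
    Fin.snoc (α := fun _ => Fin 2 × (x (Fin.last (l + 1))).n) a.2
      (a.1.1, a.1.2 (Fin.last (l + 1))) k)
  left_inv i := by
    funext k
    refine Fin.lastCases ?_ (fun k => ?_) k
    · refine Prod.ext ?_ ?_ <;> simp
    · refine Prod.ext ?_ ?_ <;> simp
  right_inv a := by
    obtain ⟨⟨s, a⟩, c⟩ := a
    refine Prod.ext (Prod.ext ?_ ?_) ?_
    · simp
    · funext k
      refine Fin.lastCases ?_ (fun k => ?_) k <;> simp
    · funext k
      simp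

/-- The embedding of the `2 × 2` matrices over `TensorMat x`. -/
noncomputable def triEmbed (j : Fin d) (x : Point K d (l + 2)) :
    Matrix (Fin 2) (Fin 2) (TensorMat x) →ₐ[K] TensorMat (triPoint j x) :=
  (amp K (triEquiv j x)).comp (Matrix.compAlgEquiv (Fin 2) (Idx x) K K).toAlgHom

theorem triEmbed_apply (j : Fin d) (x : Point K d (l + 2))
    (M : Matrix (Fin 2) (Fin 2) (TensorMat x)) (i i' : Idx (triPoint j x)) :
    triEmbed j x M i i' =
      if (fun k : Fin l => (i k.castSucc).2) = (fun k : Fin l => (i' k.castSucc).2) then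
        M (i (Fin.last l)).2.1 (i' (Fin.last l)).2.1
          (Fin.snoc (α := fun k => (x k).n) (fun k => (i k).1) (i (Fin.last l)).2.2)
          (Fin.snoc (α := fun k => (x k).n) (fun k => (i' k).1) (i' (Fin.last l)).2.2)
      else 0 := rfl

theorem triEmbed_injective (j : Fin d) (x : Point K d (l + 2)) :
    Function.Injective (triEmbed j x) :=
  (amp_injective K (triEquiv j x)).comp (Matrix.compAlgEquiv (Fin 2) (Idx x) K K).injective

/-- The case of a letter of the last tuple in `triEmbed_triHom`: the Kronecker deltas of the unused
factors amount to the same condition on both sides. The family `n` and the indices `A`, `B` are kept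
abstract so that the dependent types do not obstruct rewriting. -/
theorem triEntry_last {n : Fin (l + 2) → Type} [∀ k, DecidableEq (n k)]
    (a b : ∀ k : Fin (l + 1), n k.castSucc × Fin 2 × n (Fin.last (l + 1))) (c : Prop) [Decidable c]
    (X : n (Fin.last l).castSucc → n (Fin.last l).castSucc → K)
    (Y : n (Fin.last (l + 1)) → n (Fin.last (l + 1)) → K) (A B : ∀ k, n k)
    (hA : A = Fin.snoc (α := n) (fun k => (a k).1) (a (Fin.last l)).2.2)
    (hB : B = Fin.snoc (α := n) (fun k => (b k).1) (b (Fin.last l)).2.2) :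
    (if (fun k : Fin l => (a k.castSucc).2) = (fun k : Fin l => (b k.castSucc).2) then
      !![if ∀ r, r ≠ (Fin.last l).castSucc → A r = B r then
          X (A (Fin.last l).castSucc) (B (Fin.last l).castSucc) else 0,
        (if c then (1 : Matrix (∀ k, n k) (∀ k, n k) K) else 0) A B;
        (0 : Matrix (∀ k, n k) (∀ k, n k) K) A B,
        if ∀ r, r ≠ Fin.last (l + 1) → A r = B r then
          Y (A (Fin.last (l + 1))) (B (Fin.last (l + 1))) else 0]
        (a (Fin.last l)).2.1 (b (Fin.last l)).2.1 else 0) =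
    if ∀ r, r ≠ Fin.last l → a r = b r then
      !![if (a (Fin.last l)).2.2 = (b (Fin.last l)).2.2 then
          X (a (Fin.last l)).1 (b (Fin.last l)).1 else 0,
        if c ∧ (a (Fin.last l)).1 = (b (Fin.last l)).1 ∧ (a (Fin.last l)).2.2 = (b (Fin.last l)).2.2
          then 1 else 0;
        0, if (a (Fin.last l)).1 = (b (Fin.last l)).1 then
          Y (a (Fin.last l)).2.2 (b (Fin.last l)).2.2 else 0]
        (a (Fin.last l)).2.1 (b (Fin.last l)).2.1 else 0 := by
  have e : A = B ↔ (∀ k : Fin l, (a k.castSucc).1 = (b k.castSucc).1) ∧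
      (a (Fin.last l)).1 = (b (Fin.last l)).1 ∧ (a (Fin.last l)).2.2 = (b (Fin.last l)).2.2 := by
    rw [funext_iff, hA, hB]
    simp [Fin.forall_fin_succ', and_assoc]
  have e1 : (∀ r, r ≠ (Fin.last l).castSucc → A r = B r) ↔
      (∀ k : Fin l, (a k.castSucc).1 = (b k.castSucc).1) ∧
        (a (Fin.last l)).2.2 = (b (Fin.last l)).2.2 := by
    rw [hA, hB]
    simp [Fin.forall_fin_succ', (Fin.castSucc_ne_last (Fin.last l)).symm]
  have e2 : (∀ r, r ≠ Fin.last (l + 1) → A r = B r) ↔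
      (∀ k : Fin l, (a k.castSucc).1 = (b k.castSucc).1) ∧
        (a (Fin.last l)).1 = (b (Fin.last l)).1 := by
    rw [hA, hB]
    simp [Fin.forall_fin_succ', Fin.castSucc_ne_last]
  have e3 : (∀ r, r ≠ Fin.last l → a r = b r) ↔
      (∀ k : Fin l, (a k.castSucc).1 = (b k.castSucc).1) ∧
        ∀ k : Fin l, (a k.castSucc).2 = (b k.castSucc).2 := by
    simp [Fin.forall_fin_succ', Fin.castSucc_ne_last, Prod.ext_iff, forall_and]
  have a1 : A (Fin.last l).castSucc = (a (Fin.last l)).1 := by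
    rw [hA]; exact Fin.snoc_castSucc (α := n) _ _ _
  have b1 : B (Fin.last l).castSucc = (b (Fin.last l)).1 := by
    rw [hB]; exact Fin.snoc_castSucc (α := n) _ _ _
  have a2 : A (Fin.last (l + 1)) = (a (Fin.last l)).2.2 := by
    rw [hA]; exact Fin.snoc_last (α := n) _ _
  have b2 : B (Fin.last (l + 1)) = (b (Fin.last l)).2.2 := by
    rw [hB]; exact Fin.snoc_last (α := n) _ _
  have e4 : (if c then (1 : Matrix (∀ k, n k) (∀ k, n k) K) else 0) A B =
      if c ∧ A = B then 1 else 0 := by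
    by_cases hc : c <;> simp [hc, Matrix.one_apply]
  rw [e4, a1, b1, a2, b2]
  simp only [e, e1, e2, e3, funext_iff, Matrix.zero_apply]
  generalize (a (Fin.last l)).2.1 = s
  generalize (b (Fin.last l)).2.1 = t
  by_cases h₁ : ∀ k : Fin l, (a k.castSucc).1 = (b k.castSucc).1 <;>
    by_cases h₂ : ∀ k : Fin l, (a k.castSucc).2 = (b k.castSucc).2 <;>
    simp only [h₁, h₂, implies_true, true_and, false_and, and_false, if_true, if_false]
  fin_cases s <;> fin_cases t <;> rfl

/-- The case of a letter of one of the first l tuples. Here the 2 × 2 matrix is block scalar, and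
its diagonal becomes one more Kronecker delta. -/
theorem triEntry_castSucc {n : Fin (l + 2) → Type} [∀ k, DecidableEq (n k)] (k : Fin l)
    (a b : ∀ k : Fin (l + 1), n k.castSucc × Fin 2 × n (Fin.last (l + 1)))
    (X : n k.castSucc.castSucc → n k.castSucc.castSucc → K) (A B : ∀ k, n k)
    (hA : A = Fin.snoc (α := n) (fun k => (a k).1) (a (Fin.last l)).2.2)
    (hB : B = Fin.snoc (α := n) (fun k => (b k).1) (b (Fin.last l)).2.2) :
    (if (fun k : Fin l => (a k.castSucc).2) = (fun k : Fin l => (b k.castSucc).2) then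
      !![if ∀ r, r ≠ k.castSucc.castSucc → A r = B r then
          X (A k.castSucc.castSucc) (B k.castSucc.castSucc) else 0,
        (0 : Matrix (∀ k, n k) (∀ k, n k) K) A B;
        (0 : Matrix (∀ k, n k) (∀ k, n k) K) A B,
        if ∀ r, r ≠ k.castSucc.castSucc → A r = B r then
          X (A k.castSucc.castSucc) (B k.castSucc.castSucc) else 0]
        (a (Fin.last l)).2.1 (b (Fin.last l)).2.1 else 0) =
    if ∀ r, r ≠ k.castSucc → a r = b r then
      if (a k.castSucc).2 = (b k.castSucc).2 then X (a k.castSucc).1 (b k.castSucc).1 else 0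
      else 0 := by
  have e1 : (∀ r, r ≠ k.castSucc.castSucc → A r = B r) ↔
      (∀ r : Fin l, r ≠ k → (a r.castSucc).1 = (b r.castSucc).1) ∧
        (a (Fin.last l)).1 = (b (Fin.last l)).1 ∧
        (a (Fin.last l)).2.2 = (b (Fin.last l)).2.2 := by
    rw [hA, hB]
    simp [Fin.forall_fin_succ', and_assoc, (Fin.castSucc_ne_last _).symm]
  have e3 : (∀ r, r ≠ k.castSucc → a r = b r) ↔
      ((∀ r : Fin l, r ≠ k → (a r.castSucc).1 = (b r.castSucc).1) ∧
        (∀ r : Fin l, r ≠ k → (a r.castSucc).2 = (b r.castSucc).2)) ∧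
        (a (Fin.last l)).1 = (b (Fin.last l)).1 ∧
        (a (Fin.last l)).2.1 = (b (Fin.last l)).2.1 ∧
        (a (Fin.last l)).2.2 = (b (Fin.last l)).2.2 := by
    simp [Fin.forall_fin_succ', Prod.ext_iff, imp_and, forall_and, (Fin.castSucc_ne_last _).symm]
    tauto
  have e4 : (∀ r : Fin l, (a r.castSucc).2 = (b r.castSucc).2) ↔
      (∀ r : Fin l, r ≠ k → (a r.castSucc).2 = (b r.castSucc).2) ∧
        (a k.castSucc).2 = (b k.castSucc).2 :=
    ⟨fun h => ⟨fun r _ => h r, h k⟩, fun h r => by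
      by_cases hr : r = k
      · subst hr; exact h.2
      · exact h.1 r hr⟩
  have a1 : A k.castSucc.castSucc = (a k.castSucc).1 := by
    rw [hA]; exact Fin.snoc_castSucc (α := n) _ _ _
  have b1 : B k.castSucc.castSucc = (b k.castSucc).1 := by
    rw [hB]; exact Fin.snoc_castSucc (α := n) _ _ _
  rw [a1, b1]
  simp only [e1, e3, e4, funext_iff, Matrix.zero_apply]
  generalize (a (Fin.last l)).2.1 = s
  generalize (b (Fin.last l)).2.1 = t
  rcases Classical.propComplete (∀ r : Fin l, r ≠ k → (a r.castSucc).1 = (b r.castSucc).1)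
    with h₁ | h₁ <;>
  rcases Classical.propComplete (∀ r : Fin l, r ≠ k → (a r.castSucc).2 = (b r.castSucc).2)
    with h₂ | h₂ <;>
  rcases Classical.propComplete ((a k.castSucc).2 = (b k.castSucc).2) with h₃ | h₃ <;>
  simp only [h₁, h₂, h₃, true_and, and_true, false_and, and_false, if_true, if_false, ite_self]
  all_goals fin_cases s <;> fin_cases t <;> simp

theorem triEmbed_triHom (j : Fin d) (x : Point K d (l + 2)) (w : MultiWord d (l + 1)) :
    triEmbed j x (triHom j (kronHom x) w) = kronHom (triPoint j x) w := by
  suffices h : ((triEmbed j x : _ →* _)).comp (triHom j (kronHom x)) =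
      kronHom (triPoint j x) from DFunLike.congr_fun h w
  refine multiWord_hom_ext fun k i => ?_
  ext a b
  change triEmbed j x (triHom j (kronHom x) (Pi.mulSingle k (FreeMonoid.of i))) a b = _
  rw [triEmbed_apply, triHom_apply, insertWord_mulSingle, insertWord_mulSingle, kronHom,
    kronHom, tensorHom_mulSingle, matrix_of_two_apply]
  revert k
  refine Fin.lastCases ?_ fun k => ?_
  · rw [derivWord_mulSingle_last, Fin.succAbove_last_apply, Fin.succAbove_castSucc_self,
      triPoint_mat_last, Fin.succ_last, tensorHom_mulSingle, tensorHom_mulSingle]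
    exact triEntry_last (n := fun k => (x k).n) a b (i = j)
      ((x (Fin.last l).castSucc).mat i) ((x (Fin.last (l + 1))).mat i) _ _ rfl rfl
  · rw [derivWord_mulSingle_castSucc, Fin.succAbove_last_apply, triPoint_mat_castSucc,
      Fin.succAbove_of_castSucc_lt _ _ (by simp [Fin.lt_def]), tensorHom_mulSingle]
    exact triEntry_castSucc (n := fun k => (x k).n) k a b
      ((x k.castSucc.castSucc).mat i) _ _ rfl rfl

end TriPoint

theorem Equivalent.delta {K : Type u} [Field K] {d l p q : ℕ} (j : Fin d)
    {R S : RatExpr K d (l + 1) p q} (h : Equivalent R S) :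
    Equivalent (⟨R.1.delta j, R.2.delta j⟩ : RatExpr K d (l + 2) p q)
      ⟨S.1.delta j, S.2.delta j⟩ := by
  obtain ⟨⟨x, hR, hS⟩, h⟩ := h
  refine ⟨?_, fun x hxR hxS => ?_⟩
  -- A common point: repeat the last tuple of x. There T ⊗ 1 and ι(T) are both evaluated at x
  -- itself, so Δ_j(T) is defined.
  · have key : ∀ T : Expr K d (l + 1) p q, T.Dom x →
        (T.delta j).Dom (fun k => x ((Fin.last l).predAbove k)) := by
      intro T hT
      have h₁ := (Expr.eval_insertTuple (Fin.last (l + 1))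
        (fun k => x ((Fin.last l).predAbove k)) T (by simpa using hT)).1
      have h₂ := (Expr.eval_insertTuple (Fin.last l).castSucc
        (fun k => x ((Fin.last l).predAbove k)) T (by simpa using hT)).1
      rw [Expr.dom_iff_domHom] at h₁ h₂ ⊢
      exact (Expr.evalHom_triHom j _ T h₁ h₂).1
    exact ⟨_, key _ hR, key _ hS⟩
  -- Agreement: the value of Δ_j(T) at x is the corner of the value of T at `triPoint j x`, and the
  -- two expressions agree at that point.
  · have key : ∀ T : Expr K d (l + 1) p q, (T.delta j).Dom x → T.Dom (triPoint j x) ∧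
        T.eval (triPoint j x) = (triMatrix ((T.tensorOne).eval x) ((T.delta j).eval x)
          (T.iota.eval x)).map (triEmbed j x) := by
      intro T hT
      rw [Expr.dom_iff_domHom] at hT
      obtain ⟨h₁, h₂⟩ := Expr.domHom_of_delta j _ T hT
      obtain ⟨-, h₃, h₄⟩ := Expr.evalHom_triHom j _ T h₁ h₂
      have := Expr.evalHom_comp _ _ (triEmbed j x) (triEmbed_triHom j x) T h₃
      rw [h₄] at this
      simpa only [Expr.dom_iff_domHom, Expr.eval_eq_evalHom] using this
    obtain ⟨dR, eR⟩ := key R.1 hxR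
    obtain ⟨dS, eS⟩ := key S.1 hxS
    have e := h _ dR dS
    rw [eR, eS] at e
    have e' := Matrix.map_injective (triEmbed_injective j x) e
    ext1 a b
    simpa [triMatrix] using congrFun (congrFun (congrFun (congrFun e' a) b) 0) 1

/-! ### Expansions at zero -/

section SeriesEval

variable {K : Type u} [Field K] {d l : ℕ} {B : Type*} [Ring B] [Algebra K B]

/-- The value of a power series at a homomorphism with finite support. -/
noncomputable def seriesEval {φ : MultiWord d l →* B} (hφ : (Function.support φ).Finite)
    {p q : ℕ} (F : Series K d l p q) : Matrix (Fin p) (Fin q) B :=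
  Matrix.of fun a b => ∑ w ∈ hφ.toFinset, F w a b • φ w

variable {φ : MultiWord d l →* B} (hφ : (Function.support φ).Finite)

theorem seriesEval_eq_sum {p q : ℕ} (F : Series K d l p q) (a : Fin p) (b : Fin q)
    (T : Finset (MultiWord d l)) (hT : ∀ w ∉ T, F w a b • φ w = 0) :
    seriesEval hφ F a b = ∑ w ∈ T, F w a b • φ w := by
  classical
  have h₁ : ∑ w ∈ hφ.toFinset, F w a b • φ w = ∑ w ∈ hφ.toFinset ∪ T, F w a b • φ w :=
    Finset.sum_subset Finset.subset_union_left fun w _ hw => by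
      have : φ w = 0 := by simpa using hw
      rw [this, smul_zero]
  rw [seriesEval, Matrix.of_apply, h₁]
  exact (Finset.sum_subset Finset.subset_union_right fun w _ hw => hT w hw).symm

theorem seriesEval_one {p : ℕ} : seriesEval hφ (Series.one K d l p) = 1 := by
  ext1 a b
  rw [seriesEval_eq_sum hφ _ a b {1} (fun w hw => by
    rw [Series.one, if_neg (by simpa using hw), Matrix.zero_apply, zero_smul])]
  rw [Finset.sum_singleton, Series.one, if_pos rfl, map_one]
  by_cases h : a = b
  · subst h; simp
  · simp [Matrix.one_apply_ne h]

theorem Split.left_mul_right {w : MultiWord d l} (s : Split w) : s.left * s.right = w := by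
  funext k
  exact List.take_append_drop _ _

/-- The splitting of `u * v` into `u` and `v`. -/
def splitOfMul (u v : MultiWord d l) : Split (u * v) := fun k =>
  ⟨(u k).toList.length, by simp [FreeMonoid.toList_mul]⟩

theorem splitOfMul_left (u v : MultiWord d l) : (splitOfMul u v).left = u := by
  funext k
  exact List.take_left

theorem splitOfMul_right (u v : MultiWord d l) : (splitOfMul u v).right = v := by
  funext k
  exact List.drop_left

theorem Split.ext_left {w : MultiWord d l} {s t : Split w} (h : s.left = t.left) : s = t := by
  funext k
  have := congrArg List.length (congrFun h k)
  have hs := (s k).isLt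
  have ht := (t k).isLt
  simp only [Split.left] at this
  change (List.take _ _).length = (List.take _ _).length at this
  rw [List.length_take, List.length_take] at this
  ext
  omega

/-- Splittings of multiwords correspond to pairs (u, v). If φ(uv) ≠ 0, then u and v both lie in the
support of φ; the remaining pairs of the support contribute zero. -/
theorem seriesEval_mul {p q r : ℕ} (F : Series K d l p q) (G : Series K d l q r) :
    seriesEval hφ (F.mul G) = seriesEval hφ F * seriesEval hφ G := by
  ext1 a c
  have hL : seriesEval hφ (F.mul G) a c =
      ∑ x ∈ hφ.toFinset.sigma fun w => (Finset.univ : Finset (Split w)),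
        (F x.2.left * G x.2.right) a c • φ (x.2.left * x.2.right) := by
    rw [Finset.sum_sigma, seriesEval, Matrix.of_apply]
    refine Finset.sum_congr rfl fun w _ => ?_
    rw [Series.mul, Matrix.sum_apply, Finset.sum_smul]
    exact Finset.sum_congr rfl fun s _ => by rw [Split.left_mul_right]
  have hR : (seriesEval hφ F * seriesEval hφ G) a c =
      ∑ x ∈ hφ.toFinset ×ˢ hφ.toFinset, (F x.1 * G x.2) a c • φ (x.1 * x.2) := by
    rw [Finset.sum_product, Matrix.mul_apply]
    simp only [seriesEval, Matrix.of_apply, Finset.sum_mul_sum, Matrix.mul_apply, map_mul,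
      Finset.sum_smul]
    rw [Finset.sum_comm]
    refine Finset.sum_congr rfl fun u _ => ?_
    rw [Finset.sum_comm]
    refine Finset.sum_congr rfl fun v _ => Finset.sum_congr rfl fun b _ => ?_
    rw [smul_mul_smul_comm]
  rw [hL, hR]
  refine Finset.sum_of_injOn (fun x => (x.2.left, x.2.right)) ?_ ?_ ?_ ?_
  · rintro ⟨w, s⟩ - ⟨w', s'⟩ - h
    obtain ⟨h₁, h₂⟩ := Prod.ext_iff.mp h
    simp only at h₁ h₂
    obtain rfl : w = w' := by rw [← s.left_mul_right, ← s'.left_mul_right, h₁, h₂]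
    rw [Split.ext_left h₁]
  · rintro ⟨w, s⟩ hw
    have hw' : φ (s.left * s.right) ≠ 0 := by
      rw [s.left_mul_right]; simpa using hw
    rw [map_mul] at hw'
    simpa using And.intro (left_ne_zero_of_mul hw') (right_ne_zero_of_mul hw')
  · rintro ⟨u, v⟩ - h
    by_cases h' : φ (u * v) = 0
    · simp [h']
    · refine absurd ?_ h
      refine ⟨⟨u * v, splitOfMul u v⟩, by simpa using h', ?_⟩
      simp only [splitOfMul_left, splitOfMul_right]
  · exact fun _ _ => rfl

theorem Series.inv_apply_one {p : ℕ} (F : Series K d l p p) : F.inv 1 = (F 1)⁻¹ := by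
  have : Subsingleton (Split (1 : MultiWord d l)) :=
    ⟨fun s t => funext fun k => Subsingleton.elim (α := Fin 1) _ _⟩
  rw [Series.inv]
  simp [Series.one, Subsingleton.elim _ (0 : Split (1 : MultiWord d l))]

/-- `F.inv` is a right inverse whose constant term is again invertible, so it has a right inverse
itself and is therefore two-sided. -/
theorem seriesEval_inv {p : ℕ} (F : Series K d l p p) (h : IsUnit (F 1)) :
    seriesEval hφ F * seriesEval hφ F.inv = 1 ∧ seriesEval hφ F.inv * seriesEval hφ F = 1 := by
  have h' : IsUnit (F.inv 1) := by
    rw [Series.inv_apply_one, Matrix.isUnit_nonsing_inv_iff]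
    exact h
  have h₁ : seriesEval hφ F * seriesEval hφ F.inv = 1 := by
    rw [← seriesEval_mul, Series.mul_inv_eq_one F h, seriesEval_one]
  have h₂ : seriesEval hφ F.inv * seriesEval hφ F.inv.inv = 1 := by
    rw [← seriesEval_mul, Series.mul_inv_eq_one _ h', seriesEval_one]
  refine ⟨h₁, ?_⟩
  rw [left_inv_eq_right_inv h₁ h₂]
  exact h₂

end SeriesEval

/-! ### Evaluation at the zero point, where only the empty words survive -/

section Zero

variable {K : Type u} [Field K] {d l : ℕ}

instance (k : Fin l) : Unique (zeroPoint K d l k).n := inferInstanceAs (Unique (Fin 1))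

theorem kronHom_zeroPoint (w : MultiWord d l) (h : w ≠ 1) : kronHom (zeroPoint K d l) w = 0 := by
  obtain ⟨k, hk⟩ := Function.ne_iff.mp h
  ext i j
  rw [kronHom, tensorHom_apply, Matrix.zero_apply]
  refine Finset.prod_eq_zero (Finset.mem_univ k) ?_
  generalize w k = u at hk
  cases u using FreeMonoid.casesOn with
  | one => exact absurd rfl hk
  | of_mul i u =>
    rw [map_mul, FreeMonoid.lift_eval_of]
    rw [show (zeroPoint K d l k).mat i = 0 from rfl, zero_mul, Matrix.zero_apply]

theorem finite_support_kronHom_zeroPoint (K : Type u) [Field K] (d l : ℕ) :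
    (Function.support (kronHom (zeroPoint K d l))).Finite :=
  (Set.finite_singleton 1).subset fun w hw => by
    by_contra h
    exact hw (kronHom_zeroPoint w h)

theorem seriesEval_zeroPoint {p q : ℕ} (F : Series K d l p q) (a : Fin p) (b : Fin q) :
    seriesEval (B := TensorMat (zeroPoint K d l)) (φ := kronHom (zeroPoint K d l))
      (finite_support_kronHom_zeroPoint K d l) F a b =
      F 1 a b • (1 : TensorMat (zeroPoint K d l)) := by
  have h : ∀ w ∉ ({1} : Finset (MultiWord d l)),
      F w a b • kronHom (zeroPoint K d l) w = 0 := fun w hw => by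
    rw [kronHom_zeroPoint w (by simpa using hw), smul_zero]
  refine (seriesEval_eq_sum (B := TensorMat (zeroPoint K d l))
    (φ := kronHom (zeroPoint K d l)) _ F a b {1} h).trans ?_
  rw [Finset.sum_singleton, map_one]

/-- The identification of `TensorMat (zeroPoint K d l)` with `K`. -/
def zeroPointHom (K : Type u) [Field K] (d l : ℕ) : TensorMat (zeroPoint K d l) →+* K where
  toFun A := A default default
  map_one' := Matrix.one_apply_eq _
  map_mul' A B := by rw [Matrix.mul_apply, Fintype.sum_unique]
  map_zero' := rfl
  map_add' _ _ := rfl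

theorem isUnit_of_isUnit_seriesEval {p : ℕ} (F : Series K d l p p)
    (h : IsUnit (seriesEval (B := TensorMat (zeroPoint K d l)) (φ := kronHom (zeroPoint K d l))
      (finite_support_kronHom_zeroPoint K d l) F)) :
    IsUnit (F 1) := by
  have h' := h.map (zeroPointHom K d l).mapMatrix
  have e : (zeroPointHom K d l).mapMatrix (seriesEval (B := TensorMat (zeroPoint K d l))
      (φ := kronHom (zeroPoint K d l)) (finite_support_kronHom_zeroPoint K d l) F) = F 1 := by
    ext a b
    rw [RingHom.mapMatrix_apply, Matrix.map_apply, seriesEval_zeroPoint]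
    change F 1 a b * (1 : TensorMat (zeroPoint K d l)) default default = _
    rw [Matrix.one_apply_eq, mul_one]
  rwa [e] at h'

end Zero

namespace Expr

variable {K : Type u} [Field K] {d l : ℕ}

/-- The finite support makes φ behave like a jointly nilpotent point, at which power series can be
evaluated. The quantifier over `B` and `φ` stands inside the induction because the inverse case also
uses the zero point. -/
theorem evalHom_eq_seriesEval {p q : ℕ} (R : Expr K d l p q) :
    R.RegularAtZero → ∀ {B : Type u} [Ring B] [Algebra K B] {φ : MultiWord d l →* B}
      (hφ : (Function.support φ).Finite),
      DomHom φ R ∧ evalHom φ R = seriesEval hφ R.series := by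
  induction R with
  | poly P =>
    intro _ B _ _ φ hφ
    refine ⟨trivial, ?_⟩
    ext1 a b
    rw [seriesEval_eq_sum hφ _ a b P.support fun w hw => ?_]
    · rfl
    · rw [series, Finsupp.notMem_support_iff.mp hw, Matrix.zero_apply, zero_smul]
  | add R S hR hS =>
    intro h B _ _ φ hφ
    obtain ⟨r₁, r₂⟩ := hR h.1 hφ
    obtain ⟨s₁, s₂⟩ := hS h.2 hφ
    refine ⟨⟨r₁, s₁⟩, ?_⟩
    rw [evalHom, r₂, s₂]
    ext1 a b
    simp [seriesEval, series, add_smul, Finset.sum_add_distrib]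
  | mul R S hR hS =>
    intro h B _ _ φ hφ
    obtain ⟨r₁, r₂⟩ := hR h.1 hφ
    obtain ⟨s₁, s₂⟩ := hS h.2 hφ
    exact ⟨⟨r₁, s₁⟩, by rw [evalHom, r₂, s₂, series, seriesEval_mul]⟩
  | inv R hR =>
    intro h B _ _ φ hφ
    -- At the zero point the induction hypothesis identifies the value of R with its constant term,
    -- which is thus invertible.
    have h0 : IsUnit (R.series 1) := by
      refine isUnit_of_isUnit_seriesEval _ ?_
      rw [← (hR h.1 (B := TensorMat (zeroPoint K d l)) (φ := kronHom (zeroPoint K d l))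
        (finite_support_kronHom_zeroPoint K d l)).2, ← eval_eq_evalHom]
      exact h.2
    obtain ⟨r₁, r₂⟩ := hR h.1 hφ
    obtain ⟨m₁, m₂⟩ := seriesEval_inv hφ _ h0
    rw [← r₂] at m₁ m₂
    exact ⟨⟨r₁, ⟨⟨_, _, m₁, m₂⟩, rfl⟩⟩, ringInverse_eq_of_mul_eq_one m₁ m₂⟩
  | block R hR =>
    intro h B _ _ φ hφ
    have H := fun a b => hR a b (h a b) hφ
    refine ⟨fun a b => (H a b).1, ?_⟩
    ext1 a b
    simp only [evalHom, Matrix.of_apply, (H _ _).2, seriesEval, series]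

theorem valueAtZero_eq_series {p q : ℕ} (R : Expr K d l p q) (h : R.RegularAtZero) :
    R.valueAtZero = R.series 1 := by
  ext a b
  rw [valueAtZero, Matrix.of_apply, eval_eq_evalHom,
    (evalHom_eq_seriesEval R h (B := TensorMat (zeroPoint K d l))
      (φ := kronHom (zeroPoint K d l)) (finite_support_kronHom_zeroPoint K d l)).2,
    seriesEval_zeroPoint]
  change R.series 1 a b * (1 : TensorMat (zeroPoint K d l)) default default = _
  rw [Matrix.one_apply_eq, mul_one]

end Expr

/-! ### The expansions of the difference-differential operators -/

section Detect

variable {d l : ℕ}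

/-- Strictly upper triangular matrices that detect the word `v`. -/
def shiftTuple (K : Type u) [Field K] (v : List (Fin d)) : MatTuple K d where
  n := Fin (v.length + 1)
  mat := fun i => Matrix.of fun a b => if (b : ℕ) = a + 1 ∧ v[(a : ℕ)]? = some i then 1 else 0

/-- The matrices describe a directed path whose edges are labelled by the letters of v. The (a, b)
entry of a word counts the ways to read it from vertex a to vertex b, and there is at most one. -/
theorem lift_shiftTuple (K : Type u) [Field K] (v : List (Fin d)) (w : FreeMonoid (Fin d))
    (a b : Fin (v.length + 1)) :
    (FreeMonoid.lift (shiftTuple K v).mat w : Matrix (Fin (v.length + 1)) (Fin (v.length + 1)) K)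
      a b = if (b : ℕ) = a + w.toList.length ∧ w.toList <+: v.drop a then 1 else 0 := by
  induction w using FreeMonoid.inductionOn' generalizing a with
  | one =>
    rw [map_one]
    change (1 : Matrix (Fin (v.length + 1)) (Fin (v.length + 1)) K) a b = _
    simp [Matrix.one_apply, Fin.ext_iff, eq_comm]
  | of_mul i w ih =>
    rw [map_mul, FreeMonoid.lift_eval_of]
    change (∑ c : Fin (v.length + 1),
      (if (c : ℕ) = a + 1 ∧ v[(a : ℕ)]? = some i then (1 : K) else 0) * (FreeMonoid.lift (shiftTuple K v).mat w :
        Matrix (Fin (v.length + 1)) (Fin (v.length + 1)) K) c b) = _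
    simp only [ih]
    have hP : (b : ℕ) = a + (FreeMonoid.of i * w).toList.length ∧
        (FreeMonoid.of i * w).toList <+: v.drop a ↔ v[(a : ℕ)]? = some i ∧
          (b : ℕ) = a + 1 + w.toList.length ∧ w.toList <+: v.drop (a + 1) := by
      rw [FreeMonoid.toList_mul, FreeMonoid.toList_of, List.singleton_append, List.length_cons]
      by_cases ha : (a : ℕ) < v.length
      · rw [List.drop_eq_getElem_cons ha, List.cons_prefix_cons, List.getElem?_eq_getElem ha,
          Option.some_inj, eq_comm (a := i), add_right_comm, add_assoc (a : ℕ)]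
        tauto
      · rw [List.getElem?_eq_none (by omega), List.drop_eq_nil_of_le (by omega)]
        simp
    by_cases ha : v[(a : ℕ)]? = some i
    · obtain ⟨hlt, -⟩ := List.getElem?_eq_some_iff.mp ha
      rw [Finset.sum_eq_single ⟨a + 1, by omega⟩]
      · rw [if_pos ⟨rfl, ha⟩, one_mul]
        exact if_congr (by rw [hP]; simp only [ha, true_and]) rfl rfl
      · intro c _ hc
        rw [if_neg fun h => hc (Fin.ext h.1), zero_mul]
      · simp
    · rw [if_neg (fun h => ha (hP.mp h).1)]
      exact Finset.sum_eq_zero fun c _ => by rw [if_neg fun h => ha h.2, zero_mul]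

/-- A point that detects the coefficient of the multiword `v`. -/
def detectPoint (K : Type u) [Field K] (v : MultiWord d l) : Point K d l :=
  fun k => shiftTuple K (v k).toList

/-- The functional that reads off the coefficient of `v`. -/
def detectCoeff (K : Type u) [Field K] (v : MultiWord d l) :
    TensorMat (detectPoint K v) →ₗ[K] K where
  toFun A := A (fun k => (0 : Fin ((v k).toList.length + 1)))
    (fun k => Fin.last (v k).toList.length)
  map_add' _ _ := rfl
  map_smul' _ _ := rfl

open Classical in
-- From the first to the last vertex of the k-th path only `v k` can be read, and the Kronecker
-- product imposes this for all k at once.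
theorem detectCoeff_kronHom (K : Type u) [Field K] (v w : MultiWord d l) :
    detectCoeff K v (kronHom (detectPoint K v) w) = if w = v then 1 else 0 := by
  change kronHom (detectPoint K v) w (fun k => (0 : Fin ((v k).toList.length + 1)))
      (fun k => Fin.last (v k).toList.length) = _
  have h : ∀ k, (FreeMonoid.lift (detectPoint K v k).mat (w k) :
      Matrix (Fin ((v k).toList.length + 1)) (Fin ((v k).toList.length + 1)) K)
        (0 : Fin ((v k).toList.length + 1)) (Fin.last (v k).toList.length) =
        if w k = v k then 1 else 0 := fun k => by
    refine (lift_shiftTuple K _ (w k) _ _).trans (if_congr ?_ rfl rfl)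
    simp only [Fin.val_last, Fin.val_zero, zero_add, List.drop_zero]
    exact ⟨fun h => FreeMonoid.toList.injective (h.2.eq_of_length h.1.symm), fun h => by
      rw [h]; exact ⟨rfl, List.prefix_rfl⟩⟩
  refine (tensorHom_apply _ w _ _).trans ((Finset.prod_congr rfl fun k _ => h k).trans ?_)
  rw [Finset.prod_ite_zero]
  simp [funext_iff]

/-- A word longer than `v k` cannot be read along the k-th path, and over a finite alphabet the
shorter ones are finitely many. -/
theorem finite_support_kronHom_detectPoint (K : Type u) [Field K] (v : MultiWord d l) :
    (Function.support (kronHom (detectPoint K v))).Finite := by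
  refine (Set.Finite.pi' (t := fun k => {u : FreeMonoid (Fin d) |
    u.toList.length ≤ (v k).toList.length}) fun k => List.finite_length_le _ _).subset ?_
  intro w hw k
  by_contra h
  refine hw ?_
  ext a b
  rw [kronHom, tensorHom_apply]
  refine Finset.prod_eq_zero (Finset.mem_univ k) ?_
  refine (lift_shiftTuple K _ (w k) _ _).trans (if_neg ?_)
  rintro ⟨-, h'⟩
  have := h'.length_le
  rw [List.length_drop] at this
  simp only [Set.mem_ofPred_eq] at h
  omega

theorem detectCoeff_seriesEval {K : Type u} [Field K] (v : MultiWord d l) {p q : ℕ}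
    (F : Series K d l p q) (a : Fin p) (b : Fin q) :
    detectCoeff K v (seriesEval (B := TensorMat (detectPoint K v))
      (φ := kronHom (detectPoint K v)) (finite_support_kronHom_detectPoint K v) F a b) =
        F v a b := by
  classical
  rw [seriesEval, Matrix.of_apply, map_sum]
  simp only [map_smul, detectCoeff_kronHom, smul_eq_mul, mul_ite, mul_one, mul_zero]
  rw [Finset.sum_ite_eq', if_pos]
  rw [Set.Finite.mem_toFinset]
  intro h0
  have := detectCoeff_kronHom K v v
  rw [h0, if_pos rfl, map_zero] at this
  exact zero_ne_one this

end Detect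

/-! ### Reading off coefficients in the corner of the triangular homomorphism -/

section Merge

variable {d l : ℕ}

/-- the multiword `(v₁, …, vₗ, vₗ₊₁ g_j vₗ₊₂)` -/
def mergeWord (j : Fin d) (v : MultiWord d (l + 2)) : MultiWord d (l + 1) :=
  Fin.snoc (α := fun _ => FreeMonoid (Fin d)) (fun k : Fin l => v k.castSucc.castSucc)
    (v (Fin.last l).castSucc * FreeMonoid.of j * v (Fin.last (l + 1)))

theorem mergeWord_last (j : Fin d) (v : MultiWord d (l + 2)) :
    mergeWord j v (Fin.last l) =
      v (Fin.last l).castSucc * FreeMonoid.of j * v (Fin.last (l + 1)) := by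
  simp [mergeWord]

theorem mergeWord_snocWord (w : MultiWord d (l + 1))
    (i : Fin (w (Fin.last l)).toList.length) :
    mergeWord ((w (Fin.last l)).toList.get i) (snocWord d l (Fin.init w,
      FreeMonoid.ofList ((w (Fin.last l)).toList.take i),
        FreeMonoid.ofList ((w (Fin.last l)).toList.drop (i + 1)))) = w := by
  funext k
  refine Fin.lastCases ?_ (fun k => ?_) k
  · rw [mergeWord_last, snocWord_castSucc_last, snocWord_last]
    refine FreeMonoid.toList.injective ?_
    simp [FreeMonoid.toList_mul]
  · simp [mergeWord, Fin.init]

theorem finite_support_comp_insertWord {B : Type*} [Ring B] {φ : MultiWord d (l + 1) →* B}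
    (hφ : (Function.support φ).Finite) (k : Fin (l + 1)) :
    (Function.support (φ.comp (Expr.insertWord d k))).Finite :=
  hφ.preimage (f := Expr.insertWord d k) (Fin.insertNth_right_injective
    (α := fun _ => FreeMonoid (Fin d)) (1 : FreeMonoid (Fin d))).injOn

/-- The diagonal entries have finite support because inserting an empty word is injective. The
corner is nonzero at w only if some splitting of w lies in the support of φ, and w is recovered from
it by merging. -/
theorem finite_support_triHom {B : Type*} [Ring B] (j : Fin d) {φ : MultiWord d (l + 2) →* B}
    (hφ : (Function.support φ).Finite) : (Function.support (triHom j φ)).Finite := by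
  refine (((finite_support_comp_insertWord hφ (Fin.last (l + 1))).union
    (finite_support_comp_insertWord hφ (Fin.last l).castSucc)).union
    (hφ.image (mergeWord j))).subset fun w hw => ?_
  by_contra h
  simp only [Set.mem_union, not_or, Function.mem_support, not_not, MonoidHom.comp_apply] at h
  obtain ⟨⟨h₁, h₂⟩, h₃⟩ := h
  refine hw ?_
  have h₄ : derivWord j φ w = 0 := by
    refine Finset.sum_eq_zero fun i _ => ?_
    split_ifs with hi
    · by_contra h0
      refine h₃ ⟨_, h0, ?_⟩
      subst hi
      exact mergeWord_snocWord w i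
    · rfl
  rw [triHom_apply, h₁, h₂, h₄]
  ext i i'
  fin_cases i <;> fin_cases i' <;> rfl

open Classical in
-- With both factors prescribed, the marked letter stands at the position given by the length of the
-- left one, so at most one term of the sum survives.
theorem detectCoeff_derivWord (K : Type u) [Field K] (j : Fin d) (v : MultiWord d (l + 2))
    (w : MultiWord d (l + 1)) :
    detectCoeff K v (derivWord j (kronHom (detectPoint K v)) w) =
      if w = mergeWord j v then 1 else 0 := by
  have h : ∀ i : Fin (w (Fin.last l)).toList.length,
      detectCoeff K v (if (w (Fin.last l)).toList.get i = j then
        kronHom (detectPoint K v) (snocWord d l (Fin.init w,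
          FreeMonoid.ofList ((w (Fin.last l)).toList.take i),
          FreeMonoid.ofList ((w (Fin.last l)).toList.drop (i + 1)))) else 0) =
      if (w (Fin.last l)).toList.get i = j ∧ snocWord d l (Fin.init w,
          FreeMonoid.ofList ((w (Fin.last l)).toList.take i),
          FreeMonoid.ofList ((w (Fin.last l)).toList.drop (i + 1))) = v then 1 else 0 := fun i => by
    rw [apply_ite (detectCoeff K v), detectCoeff_kronHom, map_zero, ite_and]
  rw [derivWord, map_sum, Finset.sum_congr rfl fun i _ => h i]
  split_ifs with hw
  · subst hw
    have hl : (mergeWord j v (Fin.last l)).toList =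
        (v (Fin.last l).castSucc).toList ++ j :: (v (Fin.last (l + 1))).toList := by
      rw [mergeWord_last]; simp [FreeMonoid.toList_mul]
    have hlen : (v (Fin.last l).castSucc).toList.length <
        (mergeWord j v (Fin.last l)).toList.length := by
      rw [hl]; simp
    rw [Finset.sum_eq_single ⟨_, hlen⟩]
    · rw [if_pos]
      constructor
      · simp [hl]
      · funext k
        refine Fin.lastCases ?_ (fun k => Fin.lastCases ?_ (fun k => ?_) k) k
        · rw [snocWord_last]
          refine FreeMonoid.toList.injective ?_
          simp [hl]
        · rw [snocWord_castSucc_last]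
          refine FreeMonoid.toList.injective ?_
          simp [hl]
        · rw [snocWord_castSucc_castSucc]
          simp [mergeWord, Fin.init]
    · intro i _ hi
      refine if_neg fun h' => hi (Fin.ext ?_)
      have h2 := congrFun h'.2 (Fin.last l).castSucc
      rw [snocWord_castSucc_last] at h2
      have h3 := congrArg (fun u => u.toList.length) h2
      simp only [FreeMonoid.toList_ofList, List.length_take] at h3
      have := i.isLt
      simp only
      omega
    · simp
  · refine Finset.sum_eq_zero fun i _ => if_neg fun h' => hw ?_
    obtain ⟨rfl, rfl⟩ := h'
    exact (mergeWord_snocWord w i).symm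

end Merge

/-! ### The coefficients of Δ_j -/

namespace Expr

variable {K : Type u} [Field K] {d l : ℕ}

theorem RegularAtZero.domHom_insertTuple {p q : ℕ} {R : Expr K d l p q} (hR : R.RegularAtZero)
    {B : Type u} [Ring B] [Algebra K B] {φ : MultiWord d (l + 1) →* B}
    (hφ : (Function.support φ).Finite) (k : Fin (l + 1)) : DomHom φ (insertTuple k R) :=
  (Expr.domHom_insertTuple k φ R).mpr
    (evalHom_eq_seriesEval R hR (finite_support_comp_insertWord hφ k)).1

theorem RegularAtZero.delta {p q : ℕ} {R : Expr K d (l + 1) p q} (hR : R.RegularAtZero)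
    (j : Fin d) : (delta j R).RegularAtZero := by
  have h0 := finite_support_kronHom_zeroPoint K d (l + 2)
  rw [RegularAtZero, dom_iff_domHom]
  exact (evalHom_triHom j (B := TensorMat (zeroPoint K d (l + 2)))
    (kronHom (zeroPoint K d (l + 2))) R
    (hR.domHom_insertTuple (B := TensorMat (zeroPoint K d (l + 2))) h0 _)
    (hR.domHom_insertTuple (B := TensorMat (zeroPoint K d (l + 2))) h0 _)).1

/-- R is evaluated along `triHom` in two ways: as a triangular matrix with the value of Δ_j(R) in
the corner, and as the finite sum over its own expansion. Reading off the coefficient of v in the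
corners gives the claim. -/
theorem series_delta {p q : ℕ} {R : Expr K d (l + 1) p q} (hR : R.RegularAtZero) (j : Fin d)
    (v : MultiWord d (l + 2)) : (delta j R).series v = R.series (mergeWord j v) := by
  ext a b
  have hφ := finite_support_kronHom_detectPoint K v
  obtain ⟨-, -, h⟩ := evalHom_triHom j (B := TensorMat (detectPoint K v))
    (kronHom (detectPoint K v)) R
    (hR.domHom_insertTuple (B := TensorMat (detectPoint K v)) hφ _)
    (hR.domHom_insertTuple (B := TensorMat (detectPoint K v)) hφ _)
  rw [(evalHom_eq_seriesEval R hR (B := Matrix (Fin 2) (Fin 2) (TensorMat (detectPoint K v)))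
    (finite_support_triHom j hφ)).2,
    (evalHom_eq_seriesEval _ (hR.delta j) (B := TensorMat (detectPoint K v)) hφ).2] at h
  have h' := congrArg (detectCoeff K v) (congrFun (congrFun (congrFun (congrFun h a) b) 0) 1)
  have h₁ : detectCoeff K v (triMatrix (evalHom (kronHom (detectPoint K v)) R.tensorOne)
      (seriesEval hφ (delta j R).series) (evalHom (kronHom (detectPoint K v)) R.iota) a b 0 1) =
      (delta j R).series v a b := detectCoeff_seriesEval v (delta j R).series a b
  have h₂ : seriesEval (finite_support_triHom j hφ) R.series a b 0 1 =
      ∑ w ∈ (finite_support_triHom j hφ).toFinset,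
        R.series w a b • derivWord j (kronHom (detectPoint K v)) w := by
    rw [seriesEval, Matrix.of_apply, Matrix.sum_apply]
    rfl
  rw [h₁, h₂, map_sum] at h'
  classical
  simp only [map_smul, detectCoeff_derivWord, smul_eq_mul, mul_ite, mul_one, mul_zero] at h'
  rw [← h', Finset.sum_ite_eq', if_pos]
  rw [Set.Finite.mem_toFinset]
  intro h0
  have h4 := detectCoeff_derivWord K j v (mergeWord j v)
  have h5 : derivWord j (kronHom (detectPoint K v)) (mergeWord j v) = 0 :=
    congrFun (congrFun h0 0) 1
  rw [h5, if_pos rfl, map_zero] at h4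
  exact zero_ne_one h4

end Expr

/-- Equivalent expressions that are regular at zero have the same expansion. -/
theorem Equivalent.series_eq {K : Type u} [Field K] {d l p q : ℕ} {R S : RatExpr K d l p q}
    (h : Equivalent R S) (hR : R.1.RegularAtZero) (hS : S.1.RegularAtZero) :
    R.1.series = S.1.series := by
  funext v
  ext a b
  have hφ := finite_support_kronHom_detectPoint K v
  obtain ⟨r₁, r₂⟩ := Expr.evalHom_eq_seriesEval R.1 hR (B := TensorMat (detectPoint K v)) hφ
  obtain ⟨s₁, s₂⟩ := Expr.evalHom_eq_seriesEval S.1 hS (B := TensorMat (detectPoint K v)) hφ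
  have e := h.2 (detectPoint K v) ((Expr.dom_iff_domHom _ _).mpr r₁)
    ((Expr.dom_iff_domHom _ _).mpr s₁)
  rw [Expr.eval_eq_evalHom, Expr.eval_eq_evalHom, r₂, s₂] at e
  rw [← detectCoeff_seriesEval v R.1.series a b, ← detectCoeff_seriesEval v S.1.series a b, e]

/-! ### Specialising polynomials at commuting matrices -/

open Polynomial in
theorem exists_polynomial_aeval_ne_zero {K Ω : Type*} [Field K] [Field Ω] [Algebra K Ω]
    [Algebra.IsAlgebraic K Ω] {s : Set Ω} (hs : s.Finite) :
    ∃ h : K[X], 0 < h.natDegree ∧ ∀ y ∈ s, aeval y h ≠ 0 := by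
  set P : K[X] := ∏ y ∈ hs.toFinset, minpoly K y with hP
  have hP0 : P ≠ 0 := Finset.prod_ne_zero_iff.mpr fun y _ =>
    minpoly.ne_zero (Algebra.IsIntegral.isIntegral y)
  -- P vanishes on s, so this polynomial is 1 there; the factor X keeps the degree positive even if
  -- s is empty.
  refine ⟨X * P + 1, ?_, fun y hy => ?_⟩
  · rw [← C_1, natDegree_add_C, natDegree_X_mul hP0]
    omega
  · have : aeval y P = 0 := by
      rw [hP, map_prod]
      exact Finset.prod_eq_zero (hs.mem_toFinset.mpr hy) (minpoly.aeval K y)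
    simp [this]

open Polynomial in
/-- A nonzero polynomial over an algebraic extension of `K` does not vanish at the points whose
coordinates are roots of suitable polynomials over `K`. -/
theorem exists_polynomials_eval_ne_zero {K Ω : Type*} [Field K] [Field Ω] [Algebra K Ω]
    [Algebra.IsAlgebraic K Ω] {n : ℕ} (f : MvPolynomial (Fin n) Ω) (hf : f ≠ 0) :
    ∃ h : Fin n → K[X], (∀ k, 0 < (h k).natDegree) ∧
      ∀ x : Fin n → Ω, (∀ k, aeval (x k) (h k) = 0) → MvPolynomial.eval x f ≠ 0 := by
  induction n with
  | zero =>
    refine ⟨fun k => k.elim0, fun k => k.elim0, fun x _ h => hf ?_⟩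
    rw [MvPolynomial.eq_C_of_isEmpty f] at h ⊢
    rw [MvPolynomial.eval_C] at h
    rw [h, map_zero]
  | succ n ih =>
    -- View f as a polynomial in the first variable. Induction makes the leading coefficient nonzero
    -- on a finite set of remaining coordinates, so the first coordinate has only finitely many
    -- values to avoid.
    set g := MvPolynomial.finSuccEquiv Ω n f with hg
    have hg0 : g ≠ 0 := by simpa [hg] using hf
    obtain ⟨h, hdeg, hh⟩ := ih g.leadingCoeff (leadingCoeff_ne_zero.mpr hg0)
    set S : Set (Fin n → Ω) := {x | ∀ k, aeval (x k) (h k) = 0} with hS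
    have hSfin : S.Finite := by
      refine Set.Finite.pi' (t := fun k => {y : Ω | aeval y (h k) = 0}) fun k => ?_
      refine ((h k).rootSet_finite Ω).subset fun y hy => ?_
      exact mem_rootSet.mpr ⟨ne_zero_of_natDegree_gt (hdeg k), hy⟩
    have hne : ∀ x ∈ S, g.map (MvPolynomial.eval x) ≠ 0 := fun x hx h0 => by
      have := congrArg (fun r => r.coeff g.natDegree) h0
      simp only [coeff_map, coeff_natDegree, coeff_zero] at this
      exact hh x hx this
    have hbad : (⋃ x ∈ S, {y : Ω | (g.map (MvPolynomial.eval x)).IsRoot y}).Finite :=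
      hSfin.biUnion fun x hx => finite_setOfPred_isRoot (hne x hx)
    obtain ⟨h₀, hdeg₀, hh₀⟩ := exists_polynomial_aeval_ne_zero (K := K) hbad
    refine ⟨Fin.cons h₀ h, fun k => ?_, fun x hx h0 => ?_⟩
    · refine Fin.cases ?_ (fun k => ?_) k
      · simpa using hdeg₀
      · simpa using hdeg k
    · rw [← Fin.cons_self_tail x, MvPolynomial.eval_eq_eval_mv_eval'] at h0
      refine hh₀ (x 0) ?_ (by simpa using hx 0)
      exact Set.mem_biUnion (x := Fin.tail x) (fun k => by simpa [Fin.tail] using hx k.succ) h0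

open Polynomial in
-- Take the matrix of multiplication by the class of X on K[X]/(h); positive degree makes its size
-- nonzero.
theorem exists_matrix_aeval_eq_zero {K : Type*} [Field K] (h : K[X]) (hdeg : 0 < h.natDegree) :
    ∃ (n : ℕ) (_ : NeZero n) (T : Matrix (Fin n) (Fin n) K), aeval T h = 0 := by
  have h0 : h ≠ 0 := ne_zero_of_natDegree_gt hdeg
  set pb := AdjoinRoot.powerBasis h0
  refine ⟨pb.dim, ⟨?_⟩, Algebra.leftMulMatrix pb.basis (AdjoinRoot.root h), ?_⟩
  · rw [AdjoinRoot.powerBasis_dim]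
    exact hdeg.ne'
  · rw [aeval_algHom_apply, AdjoinRoot.aeval_eq, AdjoinRoot.mk_self, map_zero]

/-- A nonzero polynomial in `t₁, …, tₗ` becomes invertible when `tₖ` is replaced by
`1 ⊗ ⋯ ⊗ Tₖ ⊗ ⋯ ⊗ 1` for suitable matrices `Tₖ`. -/
theorem exists_isUnit_aeval {K : Type u} [Field K] {l : ℕ} (f : MvPolynomial (Fin l) K)
    (hf : f ≠ 0) :
    ∃ (r : Fin l → ℕ) (_ : ∀ k, NeZero (r k)) (T : ∀ k, Matrix (Fin (r k)) (Fin (r k)) K)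
      (A : Type u) (_ : CommRing A) (_ : Algebra K A) (t : Fin l → A)
      (ι : A →ₐ[K] Matrix (∀ k, Fin (r k)) (∀ k, Fin (r k)) K),
      (∀ k, ι (t k) = amp K (Equiv.piSplitAt k fun k => Fin (r k)) (T k)) ∧
        IsUnit (MvPolynomial.aeval t f) := by
  have hf' : MvPolynomial.map (algebraMap K (AlgebraicClosure K)) f ≠ 0 := by
    rwa [Ne, map_eq_zero_iff _ (MvPolynomial.map_injective _ (algebraMap K _).injective)]
  obtain ⟨h, hdeg, hh⟩ := exists_polynomials_eval_ne_zero (K := K) _ hf'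
  choose r hr T hT using fun k => exists_matrix_aeval_eq_zero (h k) (hdeg k)
  set s : Fin l → Matrix (∀ k, Fin (r k)) (∀ k, Fin (r k)) K := fun k =>
    amp K (Equiv.piSplitAt k fun k => Fin (r k)) (T k) with hs
  have hs' : ∀ k, s k = tensorHom (d := 1) (fun k _ => T k) (Pi.mulSingle k (FreeMonoid.of 0)) := by
    intro k
    ext a b
    rw [tensorHom_mulSingle]
    refine (amp_apply K _ _ a b).trans ?_
    refine if_congr ?_ rfl rfl
    simp [Equiv.piSplitAt, funext_iff]
  have hcomm : ∀ a ∈ Set.range s, ∀ b ∈ Set.range s, a * b = b * a := by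
    rintro _ ⟨k, rfl⟩ _ ⟨m, rfl⟩
    by_cases hkm : k = m
    · rw [hkm]
    · rw [hs', hs', ← map_mul, ← map_mul]
      congr 1
      exact Pi.mulSingle_commute hkm _ _
  have := Algebra.isMulCommutative_adjoin K hcomm
  let A := Algebra.adjoin K (Set.range s)
  let _ : CommRing A := { (inferInstance : Ring A) with mul_comm := fun a b => mul_comm' a b }
  let t : Fin l → A := fun k => ⟨s k, Algebra.subset_adjoin ⟨k, rfl⟩⟩
  refine ⟨r, hr, T, A, inferInstance, inferInstance, t, A.val, fun k => rfl, ?_⟩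
  -- A nonunit lies in a maximal ideal m, and A/m is algebraic over K, so it embeds in the algebraic
  -- closure. This produces a zero of f whose coordinates are roots of the `h k`, against their
  -- choice.
  by_contra hu
  obtain ⟨m, hm, hmem⟩ := exists_max_ideal_of_mem_nonunits hu
  let _ := Ideal.Quotient.field m
  have : Algebra.IsAlgebraic K (A ⧸ m) := inferInstance
  let ψ : A →ₐ[K] AlgebraicClosure K :=
    (IsAlgClosed.lift : (A ⧸ m) →ₐ[K] AlgebraicClosure K).comp (Ideal.Quotient.mkₐ K m)
  refine hh (fun k => ψ (t k)) (fun k => ?_) ?_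
  · have : Polynomial.aeval (t k) (h k) = 0 := by
      refine Subtype.val_injective ?_
      change A.val _ = 0
      rw [← Polynomial.aeval_algHom_apply]
      change Polynomial.aeval (amp K _ (T k)) (h k) = 0
      rw [Polynomial.aeval_algHom_apply, hT, map_zero]
    rw [Polynomial.aeval_algHom_apply, this, map_zero]
  · rw [MvPolynomial.eval_map, ← MvPolynomial.aeval_def]
    have : MvPolynomial.aeval (fun k => ψ (t k)) f = ψ (MvPolynomial.aeval t f) := by
      rw [← AlgHom.comp_apply, MvPolynomial.comp_aeval]
    rw [this]
    have h0 : Ideal.Quotient.mkₐ K m (MvPolynomial.aeval t f) = 0 :=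
      Ideal.Quotient.eq_zero_iff_mem.mpr hmem
    rw [AlgHom.comp_apply, h0, map_zero]

/-! ### Common points of the domains of two expressions -/

section Path

variable {K : Type u} [Field K] {d l : ℕ} {n : Fin l → Type} [∀ k, Fintype (n k)]
  [∀ k, DecidableEq (n k)]

/-- The point `X + t (Y - X)` with parameters `t₁, …, tₗ` in a commutative algebra. -/
noncomputable def pathHom (X Y : ∀ k, Fin d → Matrix (n k) (n k) K) {A : Type*} [CommRing A]
    [Algebra K A] (t : Fin l → A) : MultiWord d l →* Matrix (∀ k, n k) (∀ k, n k) A :=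
  tensorHom fun k j => Matrix.of fun a b =>
    algebraMap K A (X k j a b) + t k * algebraMap K A (Y k j a b - X k j a b)

theorem pathHom_zero (X Y : ∀ k, Fin d → Matrix (n k) (n k) K) :
    pathHom X Y (fun _ => (0 : K)) = tensorHom X := by
  simp [pathHom, Matrix.of]
  rfl

theorem pathHom_one (X Y : ∀ k, Fin d → Matrix (n k) (n k) K) :
    pathHom X Y (fun _ => (1 : K)) = tensorHom Y := by
  simp [pathHom, Matrix.of]
  rfl

theorem mapMatrix_pathHom (X Y : ∀ k, Fin d → Matrix (n k) (n k) K) {A A' : Type*} [CommRing A]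
    [Algebra K A] [CommRing A'] [Algebra K A'] (t : Fin l → A) (t' : Fin l → A')
    (g : A →ₐ[K] A') (hg : ∀ k, g (t k) = t' k) (w : MultiWord d l) :
    g.mapMatrix (pathHom X Y t w) = pathHom X Y t' w := by
  suffices h : (MonoidHomClass.toMonoidHom (g.mapMatrix (m := ∀ k, n k))).comp
      (pathHom X Y t) = pathHom X Y t' from DFunLike.congr_fun h w
  refine multiWord_hom_ext fun k j => ?_
  ext a b
  change g (pathHom X Y t _ a b) = _
  rw [pathHom, pathHom, tensorHom_mulSingle, tensorHom_mulSingle]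
  split_ifs <;> simp [hg]

/-- The parameters of the universal point of a localisation. -/
noncomputable def awayVar (f : MvPolynomial (Fin l) K) : Fin l → Localization.Away f :=
  fun k => algebraMap (MvPolynomial (Fin l) K) _ (MvPolynomial.X k)

theorem aeval_awayVar (f g : MvPolynomial (Fin l) K) :
    MvPolynomial.aeval (awayVar f) g = algebraMap _ (Localization.Away f) g := by
  have : MvPolynomial.aeval (awayVar f) =
      IsScalarTower.toAlgHom K (MvPolynomial (Fin l) K) (Localization.Away f) := by
    ext k; simp [awayVar]
  rw [this]; rfl

theorem exists_awayLift (f : MvPolynomial (Fin l) K) {A : Type*} [CommRing A] [Algebra K A]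
    (t : Fin l → A) (h : IsUnit (MvPolynomial.aeval t f)) :
    ∃ g : Localization.Away f →ₐ[K] A, ∀ k, g (awayVar f k) = t k := by
  refine ⟨IsLocalization.Away.liftAlgHom f (f := MvPolynomial.aeval t) h, fun k => ?_⟩
  simp [awayVar]

/-- The invertibility of an element of a localisation is detected by a polynomial. -/
theorem exists_isUnit_iff (f : MvPolynomial (Fin l) K) (δ : Localization.Away f) :
    ∃ a : MvPolynomial (Fin l) K, ∀ (A : Type u) [CommRing A] [Algebra K A] (t : Fin l → A)
      (g : Localization.Away f →ₐ[K] A), (∀ k, g (awayVar f k) = t k) →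
        (IsUnit (MvPolynomial.aeval t a) ↔ IsUnit (g δ)) := by
  obtain ⟨m, a, ha⟩ := IsLocalization.Away.surj f δ
  refine ⟨a, fun A _ _ t g hg => ?_⟩
  obtain rfl : (fun k => g (awayVar f k)) = t := funext hg
  have e : ∀ b, MvPolynomial.aeval (fun k => g (awayVar f k)) b =
      g (algebraMap _ (Localization.Away f) b) := fun b => by
    rw [← aeval_awayVar, ← AlgHom.comp_apply, MvPolynomial.comp_aeval]
  have hu : IsUnit (g (algebraMap _ (Localization.Away f) f ^ m)) :=
    ((IsLocalization.Away.algebraMap_isUnit f).pow m).map g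
  rw [e, ← ha, map_mul, hu.mul_right_iff]

/-- Flattening a matrix over a matrix algebra brings the entries into a commutative ring, where the
determinant detects invertibility. -/
theorem isUnit_iff_det {A : Type*} [CommRing A] {I : Type*} [Fintype I] [DecidableEq I] {p : ℕ}
    (M : Matrix (Fin p) (Fin p) (Matrix I I A)) :
    IsUnit M ↔ IsUnit (Matrix.comp _ _ _ _ A M).det := by
  rw [← Matrix.isUnit_iff_isUnit_det, ← MulEquiv.isUnit_map (Matrix.compRingEquiv (Fin p) I A)]
  rfl

theorem det_comp_map {A A' : Type*} [CommRing A] [CommRing A'] [Algebra K A] [Algebra K A']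
    {I : Type*} [Fintype I] [DecidableEq I] {p : ℕ}
    (M : Matrix (Fin p) (Fin p) (Matrix I I A)) (g : A →ₐ[K] A') :
    (Matrix.comp _ _ _ _ A' (M.map g.mapMatrix)).det = g (Matrix.comp _ _ _ _ A M).det :=
  (AlgHom.map_det g _).symm

/-- Being defined along the path is a Zariski open condition on t. For an inverse, the determinant
of the value at the universal point over K[t]_f is an element of the localisation, and its numerator
becomes a further factor of the polynomial. -/
theorem Expr.exists_domHom_pathHom (X Y : ∀ k, Fin d → Matrix (n k) (n k) K) (t₀ : Fin l → K)
    {p q : ℕ} (R : Expr K d l p q) :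
    DomHom (pathHom X Y t₀) R → ∃ f : MvPolynomial (Fin l) K, MvPolynomial.aeval t₀ f ≠ 0 ∧
      ∀ (A : Type u) [CommRing A] [Algebra K A] (t : Fin l → A),
        IsUnit (MvPolynomial.aeval t f) → DomHom (pathHom X Y t) R := by
  induction R with
  | poly P => exact fun _ => ⟨1, by simp, fun _ _ _ _ _ => trivial⟩
  | add R S hR hS =>
    rintro ⟨h₁, h₂⟩
    obtain ⟨f, f₀, hf⟩ := hR h₁
    obtain ⟨g, g₀, hg⟩ := hS h₂
    refine ⟨f * g, by rw [map_mul]; exact mul_ne_zero f₀ g₀, fun A _ _ t h => ?_⟩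
    rw [map_mul, IsUnit.mul_iff] at h
    exact ⟨hf A t h.1, hg A t h.2⟩
  | mul R S hR hS =>
    rintro ⟨h₁, h₂⟩
    obtain ⟨f, f₀, hf⟩ := hR h₁
    obtain ⟨g, g₀, hg⟩ := hS h₂
    refine ⟨f * g, by rw [map_mul]; exact mul_ne_zero f₀ g₀, fun A _ _ t h => ?_⟩
    rw [map_mul, IsUnit.mul_iff] at h
    exact ⟨hf A t h.1, hg A t h.2⟩
  | inv R hR =>
    rintro ⟨h₁, h₂⟩
    obtain ⟨f, f₀, hf⟩ := hR h₁
    have hL : DomHom (pathHom X Y (awayVar f)) R :=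
      hf _ _ (by rw [aeval_awayVar]; exact IsLocalization.Away.algebraMap_isUnit f)
    obtain ⟨a, ha⟩ := exists_isUnit_iff f
      (Matrix.comp _ _ _ _ _ (evalHom (pathHom X Y (awayVar f)) R)).det
    have key : ∀ (A : Type u) [CommRing A] [Algebra K A] (t : Fin l → A),
        IsUnit (MvPolynomial.aeval t f) →
          (IsUnit (MvPolynomial.aeval t a) ↔ IsUnit (evalHom (pathHom X Y t) R)) := by
      intro A _ _ t ht
      obtain ⟨g, hg⟩ := exists_awayLift f t ht
      rw [ha A t g hg, isUnit_iff_det,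
        (evalHom_comp _ _ g.mapMatrix (mapMatrix_pathHom X Y _ t g hg) R hL).2, det_comp_map]
    refine ⟨f * a, ?_, fun A _ _ t h => ?_⟩
    · rw [map_mul]
      exact mul_ne_zero f₀ ((key K t₀ f₀.isUnit).mpr h₂).ne_zero
    · rw [map_mul, IsUnit.mul_iff] at h
      exact ⟨hf A t h.1, (key A t h.1).mp h.2⟩
  | block R hR =>
    intro h
    choose f f₀ hf using fun a b => hR a b (h a b)
    refine ⟨∏ a, ∏ b, f a b, ?_, fun A _ _ t h a b => hf a b A t ?_⟩
    · simp only [map_prod]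
      exact Finset.prod_ne_zero_iff.mpr fun a _ => Finset.prod_ne_zero_iff.mpr fun b _ => f₀ a b
    · refine isUnit_of_dvd_unit (map_dvd _ ?_) h
      exact (Finset.dvd_prod_of_mem (fun b => f a b) (Finset.mem_univ b)).trans
        (Finset.dvd_prod_of_mem (fun a => ∏ b, f a b) (Finset.mem_univ a))

/-- The point `X ⊗ 1 + (Y - X) ⊗ T`. -/
def pathPoint (X Y : ∀ k, Fin d → Matrix (n k) (n k) K) [∀ k, Nonempty (n k)] (r : Fin l → ℕ)
    [∀ k, NeZero (r k)] (T : ∀ k, Matrix (Fin (r k)) (Fin (r k)) K) : Point K d l := fun k =>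
  { n := n k × Fin (r k)
    mat := fun j => Matrix.of fun a b =>
      (if a.2 = b.2 then X k j a.1 b.1 else 0) + (Y k j a.1 b.1 - X k j a.1 b.1) * T k a.2 b.2 }

/-- Substitution of matrices for the elements of a commutative algebra. -/
noncomputable def pathEmbed (X Y : ∀ k, Fin d → Matrix (n k) (n k) K) [∀ k, Nonempty (n k)]
    (r : Fin l → ℕ) [∀ k, NeZero (r k)] (T : ∀ k, Matrix (Fin (r k)) (Fin (r k)) K) {A : Type*}
    [CommRing A] [Algebra K A] (ι : A →ₐ[K] Matrix (∀ k, Fin (r k)) (∀ k, Fin (r k)) K) :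
    Matrix (∀ k, n k) (∀ k, n k) A →ₐ[K] TensorMat (pathPoint X Y r T) :=
  ((Matrix.reindexAlgEquiv K K
    (Equiv.arrowProdEquivProdArrow (Fin l) n fun k => Fin (r k)).symm).toAlgHom.comp
      (Matrix.compAlgEquiv _ _ K K).toAlgHom).comp ι.mapMatrix

theorem pathEmbed_apply (X Y : ∀ k, Fin d → Matrix (n k) (n k) K) [∀ k, Nonempty (n k)]
    (r : Fin l → ℕ) [∀ k, NeZero (r k)] (T : ∀ k, Matrix (Fin (r k)) (Fin (r k)) K) {A : Type*}
    [CommRing A] [Algebra K A] (ι : A →ₐ[K] Matrix (∀ k, Fin (r k)) (∀ k, Fin (r k)) K)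
    (M : Matrix (∀ k, n k) (∀ k, n k) A) (a b : ∀ k, n k × Fin (r k)) :
    pathEmbed X Y r T ι M a b =
      ι (M (fun k => (a k).1) (fun k => (b k).1)) (fun k => (a k).2) (fun k => (b k).2) := rfl

theorem pathEmbed_pathHom (X Y : ∀ k, Fin d → Matrix (n k) (n k) K) [∀ k, Nonempty (n k)]
    (r : Fin l → ℕ) [∀ k, NeZero (r k)] (T : ∀ k, Matrix (Fin (r k)) (Fin (r k)) K) {A : Type*}
    [CommRing A] [Algebra K A] (ι : A →ₐ[K] Matrix (∀ k, Fin (r k)) (∀ k, Fin (r k)) K)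
    (t : Fin l → A)
    (ht : ∀ k, ι (t k) = amp K (Equiv.piSplitAt k fun k => Fin (r k)) (T k))
    (w : MultiWord d l) :
    pathEmbed X Y r T ι (pathHom X Y t w) = kronHom (pathPoint X Y r T) w := by
  suffices h : ((pathEmbed X Y r T ι : _ →* _)).comp (pathHom X Y t) =
      kronHom (pathPoint X Y r T) from DFunLike.congr_fun h w
  refine multiWord_hom_ext fun k j => ?_
  ext a b
  refine (pathEmbed_apply X Y r T ι _ a b).trans ?_
  refine Eq.trans ?_ (tensorHom_mulSingle _ k j a b).symm
  rw [pathHom, tensorHom_mulSingle]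
  have e : (∀ m, m ≠ k → a m = b m) ↔
      (∀ m, m ≠ k → (a m).1 = (b m).1) ∧ ∀ m, m ≠ k → (a m).2 = (b m).2 :=
    ⟨fun h => ⟨fun m hm => congrArg Prod.fst (h m hm), fun m hm => congrArg Prod.snd (h m hm)⟩,
      fun h m hm => Prod.ext (h.1 m hm) (h.2 m hm)⟩
  by_cases h₁ : ∀ m, m ≠ k → (a m).1 = (b m).1
  · rw [if_pos h₁, Matrix.of_apply, map_add, map_mul, AlgHom.commutes, AlgHom.commutes, ht,
      ← Algebra.commutes, ← Algebra.smul_def]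
    refine (congrArg₂ (· + ·) (Matrix.algebraMap_matrix_apply (R := K)) rfl :
      _ = (if (fun m => (a m).2) = (fun m => (b m).2) then
        algebraMap K K (X k j (a k).1 (b k).1) else 0) +
          (Y k j (a k).1 (b k).1 - X k j (a k).1 (b k).1) *
            (if (fun m : {m // m ≠ k} => (a m).2) = (fun m : {m // m ≠ k} => (b m).2) then
              T k (a k).2 (b k).2 else 0)).trans ?_
    have e₁ : (fun m => (a m).2) = (fun m => (b m).2) ↔
        (a k).2 = (b k).2 ∧ ∀ m, m ≠ k → (a m).2 = (b m).2 :=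
      ⟨fun h => ⟨congrFun h k, fun m _ => congrFun h m⟩, fun h => funext fun m => by
        by_cases hm : m = k
        · subst hm; exact h.1
        · exact h.2 m hm⟩
    have e₂ : (fun m : {m // m ≠ k} => (a m).2) = (fun m : {m // m ≠ k} => (b m).2) ↔
        ∀ m, m ≠ k → (a m).2 = (b m).2 :=
      ⟨fun h m hm => congrFun h ⟨m, hm⟩, fun h => funext fun m => h m.1 m.2⟩
    by_cases h₂ : ∀ m, m ≠ k → (a m).2 = (b m).2
    · rw [if_pos (e.mpr ⟨h₁, h₂⟩), if_pos (e₂.mpr h₂)]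
      exact congrArg₂ (· + ·) (if_congr (e₁.trans (and_iff_left h₂)) rfl rfl) rfl
    · rw [if_neg (fun h => h₂ (e.mp h).2), if_neg (fun h => h₂ (e₂.mp h)),
        if_neg (fun h => h₂ (e₁.mp h).2), mul_zero, add_zero]
  · rw [if_neg h₁, if_neg (fun h => h₁ (e.mp h).1), map_zero, Matrix.zero_apply]

/-- Two expressions that are defined at points of the same sizes are both defined at some point. -/
theorem exists_common_point_of_pathHom (X Y : ∀ k, Fin d → Matrix (n k) (n k) K)
    [∀ k, Nonempty (n k)] {p q p' q' : ℕ} (R : Expr K d l p q) (S : Expr K d l p' q')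
    (hR : R.DomHom (tensorHom X)) (hS : S.DomHom (tensorHom Y)) :
    ∃ z : Point K d l, R.Dom z ∧ S.Dom z ∧ (R.evalHom (tensorHom X) ≠ 0 → R.eval z ≠ 0) := by
  rw [← pathHom_zero X Y] at hR
  rw [← pathHom_one X Y] at hS
  rw [← pathHom_zero X Y]
  obtain ⟨f, f₀, hf⟩ := R.exists_domHom_pathHom X Y _ hR
  obtain ⟨g, g₀, hg⟩ := S.exists_domHom_pathHom X Y _ hS
  have hL : R.DomHom (pathHom X Y (awayVar f)) :=
    hf _ _ (by rw [aeval_awayVar]; exact IsLocalization.Away.algebraMap_isUnit f)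
  -- A third polynomial keeps one nonzero entry of the value of R invertible; if the value at X is
  -- zero there is nothing to keep, and it is 1.
  obtain ⟨a, a₀, ha⟩ : ∃ a : MvPolynomial (Fin l) K,
      MvPolynomial.aeval (fun _ => (0 : K)) a ≠ 0 ∧
      (R.evalHom (pathHom X Y fun _ => (0 : K)) ≠ 0 → ∃ i i' j j',
        ∀ (A : Type u) [CommRing A] [Algebra K A] (t : Fin l → A),
          IsUnit (MvPolynomial.aeval t f) → IsUnit (MvPolynomial.aeval t a) →
            IsUnit (R.evalHom (pathHom X Y t) i i' j j')) := by
    by_cases h : R.evalHom (pathHom X Y fun _ => (0 : K)) = 0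
    · exact ⟨1, by simp, fun h' => absurd h h'⟩
    · obtain ⟨i, i', j, j', hij⟩ : ∃ i i' j j',
          R.evalHom (pathHom X Y fun _ => (0 : K)) i i' j j' ≠ 0 := by
        by_contra! h0
        exact h (by ext i i' j j'; exact h0 i i' j j')
      obtain ⟨a, ha⟩ := exists_isUnit_iff f (R.evalHom (pathHom X Y (awayVar f)) i i' j j')
      have key : ∀ (A : Type u) [CommRing A] [Algebra K A] (t : Fin l → A),
          IsUnit (MvPolynomial.aeval t f) → (IsUnit (MvPolynomial.aeval t a) ↔
            IsUnit (R.evalHom (pathHom X Y t) i i' j j')) := by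
        intro A _ _ t ht
        obtain ⟨g, hg⟩ := exists_awayLift f t ht
        rw [ha A t g hg,
          (Expr.evalHom_comp _ _ g.mapMatrix (mapMatrix_pathHom X Y _ t g hg) R hL).2]
        rfl
      exact ⟨a, ((key K _ f₀.isUnit).mpr hij.isUnit).ne_zero,
        fun _ => ⟨i, i', j, j', fun A _ _ t ht => (key A t ht).mp⟩⟩
  -- The factors f and a are nonzero at t = 0 and g is nonzero at t = 1; no common scalar is
  -- claimed.
  have hne : f * a * g ≠ 0 := by
    refine mul_ne_zero (mul_ne_zero ?_ ?_) ?_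
    · rintro rfl; exact f₀ (map_zero _)
    · rintro rfl; exact a₀ (map_zero _)
    · rintro rfl; exact g₀ (map_zero _)
  obtain ⟨r, hr, T, A, _, _, t, ι, hι, hu⟩ := exists_isUnit_aeval _ hne
  rw [map_mul, map_mul, IsUnit.mul_iff, IsUnit.mul_iff] at hu
  obtain ⟨⟨uf, ua⟩, ug⟩ := hu
  obtain ⟨r₁, r₂⟩ := Expr.evalHom_comp _ _ _ (pathEmbed_pathHom X Y r T ι t hι) R (hf A t uf)
  obtain ⟨s₁, -⟩ := Expr.evalHom_comp _ _ _ (pathEmbed_pathHom X Y r T ι t hι) S (hg A t ug)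
  refine ⟨pathPoint X Y r T, (Expr.dom_iff_domHom _ _).mpr r₁, (Expr.dom_iff_domHom _ _).mpr s₁,
    fun h h0 => ?_⟩
  obtain ⟨i, i', j, j', hij⟩ := ha h
  rw [Expr.eval_eq_evalHom, r₂] at h0
  have h1 : ι (R.evalHom (pathHom X Y t) i i' j j') = 0 := by
    ext b c
    exact congrFun (congrFun (congrFun (congrFun h0 i) i') fun k => (j k, b k))
      fun k => (j' k, c k)
  have h2 := (hij A t uf ua).map ι
  rw [h1] at h2
  exact not_isUnit_zero h2

end Path

/-! ### Transitivity of equivalence -/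

section Transitivity

variable {K : Type u} [Field K] {d l : ℕ}

/-- The matrices `Z ⊗ 1`. -/
def ampTuple (n : Fin l → Type) [∀ k, Fintype (n k)] [∀ k, DecidableEq (n k)] (x : Point K d l)
    {E : Fin l → Type} [∀ k, DecidableEq (E k)] (e : ∀ k, n k ≃ (x k).n × E k) :
    ∀ k, Fin d → Matrix (n k) (n k) K := fun k j => Matrix.of fun a b =>
  if (e k a).2 = (e k b).2 then (x k).mat j (e k a).1 (e k b).1 else 0

theorem amp_kronHom (n : Fin l → Type) [∀ k, Fintype (n k)] [∀ k, DecidableEq (n k)]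
    (x : Point K d l) {E : Fin l → Type} [∀ k, Fintype (E k)] [∀ k, DecidableEq (E k)]
    (e : ∀ k, n k ≃ (x k).n × E k) (w : MultiWord d l) :
    amp K ((Equiv.piCongrRight e).trans
      (Equiv.arrowProdEquivProdArrow (Fin l) (fun k => (x k).n) E)) (kronHom x w) =
      tensorHom (ampTuple n x e) w := by
  suffices h : (MonoidHomClass.toMonoidHom (amp (A := K) K ((Equiv.piCongrRight e).trans
      (Equiv.arrowProdEquivProdArrow (Fin l) (fun k => (x k).n) E)))).comp (kronHom x) =
      tensorHom (ampTuple n x e) from DFunLike.congr_fun h w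
  refine multiWord_hom_ext fun k j => ?_
  ext a b
  refine (amp_apply K _ _ a b).trans ?_
  rw [tensorHom_mulSingle, kronHom, tensorHom_mulSingle]
  have e₁ : ((fun m => (e m (a m)).2) = fun m => (e m (b m)).2) ↔
      (e k (a k)).2 = (e k (b k)).2 ∧ ∀ m, m ≠ k → (e m (a m)).2 = (e m (b m)).2 :=
    ⟨fun h => ⟨congrFun h k, fun m _ => congrFun h m⟩, fun h => funext fun m => by
      by_cases hm : m = k
      · subst hm; exact h.1
      · exact h.2 m hm⟩
  have e₂ : (∀ m, m ≠ k → a m = b m) ↔ (∀ m, m ≠ k → (e m (a m)).1 = (e m (b m)).1) ∧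
      ∀ m, m ≠ k → (e m (a m)).2 = (e m (b m)).2 :=
    ⟨fun h => ⟨fun m hm => by rw [h m hm], fun m hm => by rw [h m hm]⟩,
      fun h m hm => (e m).injective (Prod.ext (h.1 m hm) (h.2 m hm))⟩
  change (if ((fun m => (e m (a m)).2) = fun m => (e m (b m)).2) then
    (if ∀ m, m ≠ k → (e m (a m)).1 = (e m (b m)).1 then
      (x k).mat j (e k (a k)).1 (e k (b k)).1 else 0) else 0) =
    if ∀ m, m ≠ k → a m = b m then
      (if (e k (a k)).2 = (e k (b k)).2 then (x k).mat j (e k (a k)).1 (e k (b k)).1 else 0) else 0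
  rw [← ite_and, ← ite_and]
  refine if_congr ?_ rfl rfl
  rw [e₁, e₂]
  tauto

/-- Two expressions with nonempty domains have a common point in their domains. -/
theorem exists_common_point {p q p' q' : ℕ} (R : Expr K d l p q) (S : Expr K d l p' q')
    {x y : Point K d l} (hR : R.Dom x) (hS : S.Dom y) :
    ∃ z : Point K d l, R.Dom z ∧ S.Dom z ∧ (R.eval x ≠ 0 → R.eval z ≠ 0) := by
  rw [Expr.dom_iff_domHom] at hR hS
  -- Both points are brought to the product sizes, x in the form Z ⊗ 1 and y in the form 1 ⊗ Z.
  obtain ⟨r₁, r₂⟩ := Expr.evalHom_comp _ _ _ (amp_kronHom (fun k => (x k).n × (y k).n) x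
    fun k => Equiv.refl _) R hR
  obtain ⟨s₁, -⟩ := Expr.evalHom_comp _ _ _ (amp_kronHom (fun k => (x k).n × (y k).n) y
    fun k => Equiv.prodComm _ _) S hS
  obtain ⟨z, z₁, z₂, z₃⟩ := exists_common_point_of_pathHom _ _ R S r₁ s₁
  refine ⟨z, z₁, z₂, fun h => z₃ fun h' => h ?_⟩
  rw [r₂] at h'
  rw [Expr.eval_eq_evalHom]
  refine Matrix.map_injective (amp_injective K ((Equiv.piCongrRight fun k => Equiv.refl _).trans
    (Equiv.arrowProdEquivProdArrow (Fin l) (fun k => (x k).n) fun k => (y k).n))) (h'.trans ?_)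
  exact (Matrix.map_zero _ (map_zero _)).symm

theorem Equivalent.symm {p q : ℕ} {R S : RatExpr K d l p q} (h : Equivalent R S) :
    Equivalent S R :=
  ⟨h.1.imp fun _ hx => hx.symm, fun x hS hR => (h.2 x hR hS).symm⟩

/-- If R and T differed at a point, R − T would have a nonzero value there. That value can be kept
nonzero at a point where S is defined as well, but there both agree with S. -/
theorem Equivalent.trans {p q : ℕ} {R S T : RatExpr K d l p q} (h₁ : Equivalent R S)
    (h₂ : Equivalent S T) : Equivalent R T := by
  obtain ⟨⟨x, xR, xS⟩, e₁⟩ := h₁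
  obtain ⟨⟨y, yS, yT⟩, e₂⟩ := h₂
  refine ⟨?_, fun z zR zT => ?_⟩
  · obtain ⟨z, zR, zT, -⟩ := exists_common_point R.1 T.1 xR yT
    exact ⟨z, zR, zT⟩
  · have eval_sub : ∀ z : Point K d l, (Expr.add R.1 (.mul (.const (-1)) T.1)).eval z =
        R.1.eval z - T.1.eval z := fun z => by
      rw [Expr.eval, Expr.eval, Expr.eval_eq_evalHom z (Expr.const _), Expr.evalHom_const,
        Matrix.neg_mul, Matrix.one_mul, sub_eq_add_neg]
    have hd : (Expr.add R.1 (.mul (.const (-1)) T.1)).Dom z := And.intro zR (And.intro trivial zT)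
    obtain ⟨z', hd', zS', hz⟩ := exists_common_point _ S.1 hd xS
    obtain ⟨zR', -, zT'⟩ : R.1.Dom z' ∧ True ∧ T.1.Dom z' := hd'
    by_contra hne
    refine hz ?_ ?_
    · rw [eval_sub]
      exact sub_ne_zero.mpr hne
    · rw [eval_sub, e₁ z' zR' zS', e₂ z' zS' zT', sub_self]

/-- `Quot` identifies along the generated equivalence relation. The alternative R = S takes the
place of reflexivity, which would require a point in the domain. -/
theorem RatFun.mk_eq_mk {p q : ℕ} {R S : RatExpr K d l p q} (h : RatFun.mk R = RatFun.mk S) :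
    R = S ∨ Equivalent R S := by
  have h' := Quot.eqvGen_exact h
  clear h
  induction h' with
  | rel R S h => exact Or.inr h
  | refl R => exact Or.inl rfl
  | symm R S _ ih => exact ih.imp Eq.symm Equivalent.symm
  | trans R S T _ _ ih₁ ih₂ =>
    rcases ih₁ with rfl | h₁
    · exact ih₂
    · rcases ih₂ with rfl | h₂
      · exact Or.inr h₁
      · exact Or.inr (h₁.trans h₂)

end Transitivity

/-! ### Higher difference-differential operators -/

/-- Rebracketing of the alternating product: each letter is grouped with the word before it instead
of the word after it, so that the last letter can be split off. -/
theorem mul_prod_ofFn_eq {M : Type*} [Monoid M] {n : ℕ} (a : Fin n → M) (u : Fin (n + 1) → M) :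
    u 0 * (List.ofFn fun k => a k * u k.succ).prod =
      (List.ofFn fun k => u k.castSucc * a k).prod * u (Fin.last n) := by
  induction n with
  | zero => simp
  | succ n ih =>
    have := ih (fun k => a k.succ) fun k => u k.succ
    rw [List.ofFn_succ, List.ofFn_succ, List.prod_cons, List.prod_cons, ← Fin.succ_last]
    simp only [mul_assoc, ← Fin.succ_castSucc, Fin.castSucc_zero] at this ⊢
    rw [this]

/-- The head of the list belongs to the operator applied last, so its letter stands between the last
two words, which is where `mergeWord` inserts it. -/
theorem interleave_cons {d : ℕ} (j : Fin d) (w : List (Fin d)) (v : MultiWord d (w.length + 2)) :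
    interleave (j :: w) v = interleave w (mergeWord j v) := by
  have h₁ := mul_prod_ofFn_eq (n := w.length + 1)
    (fun k => FreeMonoid.of ((j :: w).get k.rev)) v
  have h₂ := mul_prod_ofFn_eq (fun k => FreeMonoid.of (w.get k.rev)) (mergeWord j v)
  refine h₁.trans (Eq.trans ?_ h₂.symm)
  rw [mergeWord_last, List.ofFn_succ', List.concat_eq_append, List.prod_append]
  simp only [Fin.rev_last, Fin.rev_castSucc, mergeWord, Fin.snoc_castSucc, mul_assoc,
    List.prod_singleton, List.get_cons_succ', List.get_cons_zero]

theorem interleave_one {d : ℕ} (w : List (Fin d)) :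
    interleave w 1 = FreeMonoid.ofList w.reverse := by
  have h : List.ofFn (fun k : Fin w.length => w.get k.rev) = w.reverse := by
    refine List.ext_getElem (by simp) fun i h₁ h₂ => ?_
    simp
    congr 1
    omega
  have h' : ∀ v : List (Fin d), (v.map FreeMonoid.of).prod = FreeMonoid.ofList v := fun v => by
    induction v with
    | nil => rfl
    | cons i v ih => rw [List.map_cons, List.prod_cons, ih, FreeMonoid.ofList_cons]
  rw [← h, ← h', List.map_ofFn, interleave]
  simp [Function.comp_def]

/-! ### Conclusions for functions -/

namespace RatFun

variable {K : Type u} [Field K] {d l p q : ℕ}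

theorem hasExpansion_mk {R : RatExpr K d l p q} (hR : R.1.RegularAtZero) :
    (mk R).HasExpansion R.1.series :=
  ⟨⟨R, rfl, hR⟩, fun S hS hS₀ => by
    rcases mk_eq_mk hS with rfl | h
    · rfl
    · exact h.series_eq hS₀ hR⟩

theorem HasExpansion.hasValueAtZero {f : RatFun K d l p q} {c : Series K d l p q}
    (h : f.HasExpansion c) : f.HasValueAtZero (c 1) :=
  ⟨h.1, fun R hR hR₀ => by rw [Expr.valueAtZero_eq_series _ hR₀, h.2 R hR hR₀]⟩

theorem isDelta_mk (j : Fin d) (R : RatExpr K d (l + 1) p q) :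
    IsDelta j (mk R) (mk ⟨R.1.delta j, R.2.delta j⟩) := by
  intro S hS
  rcases mk_eq_mk hS with rfl | h
  · rfl
  · exact Quot.sound (h.delta j)

/-- The induction carries a representative regular at zero, since `series_delta` applies to
expressions; `isDelta_mk` makes the class independent of it. -/
theorem exists_isHigherDelta {R : RatExpr K d 1 p q} (hR : R.1.RegularAtZero)
    (w : List (Fin d)) : ∃ S : RatExpr K d (w.length + 1) p q, S.1.RegularAtZero ∧
      IsHigherDelta w (mk R) (mk S) ∧
        S.1.series = fun u => R.1.series fun _ => interleave w u := by
  induction w with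
  | nil =>
    refine ⟨R, hR, rfl, ?_⟩
    funext u
    congr 1
    funext k
    obtain rfl : k = 0 := Subsingleton.elim (α := Fin 1) k 0
    simp [interleave]
  | cons j w ih =>
    obtain ⟨S, hS, hw, hs⟩ := ih
    refine ⟨⟨S.1.delta j, S.2.delta j⟩, hS.delta j, ⟨mk S, hw, isDelta_mk j S⟩, ?_⟩
    funext u
    refine (Expr.series_delta hS j u).trans ?_
    rw [hs, interleave_cons]

end RatFun

end NCRat

/-- The formal power series expansions of `Δ_j M` and of `Δ^w M`. -/
theorem mainTheorem7 {K : Type u} [Field K] (d p q : ℕ) (M : NCRat.RatFun K d 1 p q)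
    (hM : M.RegularAtZero) :
    ∃ c : FreeMonoid (Fin d) → Matrix (Fin p) (Fin q) K,
      M.HasExpansion (fun u => c (u 0)) ∧
      (∀ j : Fin d, ∃ D : NCRat.RatFun K d 2 p q, NCRat.RatFun.IsDelta j M D ∧
        D.HasExpansion (fun u => c (u 0 * FreeMonoid.of j * u 1))) ∧
      (∀ w : List (Fin d), ∃ D : NCRat.RatFun K d (w.length + 1) p q,
        NCRat.RatFun.IsHigherDelta w M D ∧
        D.HasExpansion (fun u => c (NCRat.interleave w u)) ∧
        D.HasValueAtZero (c (FreeMonoid.ofList w.reverse))) := by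
  obtain ⟨R, rfl, hR⟩ := hM
  refine ⟨fun u => R.1.series fun _ => u, ?_, fun j => ?_, fun w => ?_⟩
  · convert NCRat.RatFun.hasExpansion_mk hR using 3 with u
    funext k
    rw [Subsingleton.elim k 0]
  · refine ⟨_, NCRat.RatFun.isDelta_mk j R, ?_⟩
    convert NCRat.RatFun.hasExpansion_mk
      (R := ⟨R.1.delta j, R.2.delta j⟩) (hR.delta j) using 1
    funext u
    rw [NCRat.Expr.series_delta hR j u]
    congr 1
  · obtain ⟨S, hS, hw, hs⟩ := NCRat.RatFun.exists_isHigherDelta hR w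
    have h := NCRat.RatFun.hasExpansion_mk hS
    rw [hs] at h
    refine ⟨_, hw, h, ?_⟩
    rw [← NCRat.interleave_one]
    exact h.hasValueAtZero
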